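/- **Server Cloud Scheduling.** An instance consists of a finite directed acyclic graph $G=(\mathcal J,E)$ on $n=|\mathcal J|$ jobs with exactly one source $\mathcal S$ and exactly one sink $\mathcal T$, processing times $p_s(j)\in\mathbb N_0$ on the server and $p_c(j)\in\mathbb N_0$ in the cloud for every job $j$, except that $p_s(\mathcal S)=p_s(\mathcal T)=0$ and $p_c(\mathcal S)=p_c(\mathcal T)=\infty$, delays $c(i,j)\in\mathbb N_0$ for $(i,j)\in E$, and a deadline $d\in\mathbb N$, $d\ge 1$. A schedule $\pi$ partitions $\mathcal J$ into server jobs and cloud jobs and gives each job a completion time $C_j\in\mathbb N_0$. Write $p_\pi(j)$ for $p_s(j)$ or $p_c(j)$, according to where $j$ is processed. The schedule is valid if every start time $C_j-p_\pi(j)$ is nonnegative; for any two different server jobs $i,j$, $C_i\le C_j-p_\pi(j)$ or $C_j\le C_i-p_\pi(i)$; and for every $(i,j)\in E$, $C_i\le C_j-p_\pi(j)$ if $i,j$ are both on the server or both in the cloud, and $C_i+c(i,j)\le C_j-p_\pi(j)$ otherwise. Its makespan is $C_{\mathcal T}$; its cost is $\sum_{j\text{ in the cloud}}p_c(j)$.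 Let $$\phi(G)=\max_A\bigl|\{(j,k)\in E: j\in A,\ k\notin A\}\bigr|,$$ where $A$ ranges over the sets of jobs with $\mathcal S\in A$ into which no edge leads from $\mathcal J\setminus A$. **Dynamic program.** A state of a running schedule consists of the timestamp $t$, the time $f_s$ for which the server has been unused, the open edges $(j,k)$ ($j$ already processed, $k$ not), and for each tail $j$ of an open edge its location and the time $f_j$ since it finished. A list of states, sorted by value (the least cost known to reach the state) and without repetitions, starts with the state in which only $\mathcal S$ is processed, at time $0$. For $t=0,1,\dots,d$ the list is traversed once in order. For each state, each unprocessed job all of whose incoming edges are open, and each of the two locations, if the job can be finished exactly at time $t$ there (for the server, $f_s\ge p_s(j)$; in both cases, for every predecessor $k$, $f_k$ is at least the processing time plus, if the locations differ, the delay), the resulting state is inserted, or updated if its value decreases. Then $t$, $f_s$ and all $f_j$ are increased by $1$. Each state carries the list of processed jobs with their locations and completion times. In the end the first state with $t=d$ and without open edges is returned, if there is one. **With scaling.** Given $\varepsilon>0$, put $\sigma=\varepsilon d/(2n)$, replace $p_s,p_c,c$ by $\lfloor p_s/\sigma\rfloor,\lfloor p_c/\sigma\rfloor,\lfloor c/\sigma\rfloor$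 (with $\lfloor\infty/\sigma\rfloor=\infty$) and $d$ by $\lceil d/\sigma\rceil$, and run the dynamic program, still computing costs from the original $p_c$. If it returns a schedule, go through its jobs in the order of their start times, starting each job at $\sigma$ times its scaled start time plus the current total shift, or, if that is not yet possible (server busy, predecessor unfinished, or communication not done), at the earliest later time at which it is possible, and adding the extra delay to the shift of all remaining jobs. Finally round all completion times down to integers. **Theorem.** For every constant $\phi$ there is a polynomial bound $P_\phi$ in $n$ and $1/\varepsilon$ such that, for every instance with $\phi(G)\le\phi$, every deadline $d\ge1$ and every real $\varepsilon>0$, the dynamic program with scaling 1. takes at most $P_\phi(n,1/\varepsilon)$ steps, with unit cost for arithmetic operations, comparisons and roundings of numbers and for elementary operations on arrays and lists; 2. whenever it returns a schedule $\pi$, this $\pi$ is a valid schedule for the original instance with makespan at most $(1+\varepsilon)d$; 3. if there is a valid schedule with makespan at most $d$, it does return a schedule $\pi$, and the cost of $\pi$ is at most that of every valid schedule with makespan at most $d$. -/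

import Mathlib

/-!
Server Cloud Scheduling: the model, the dynamic program over states of a running schedule, its
combination with scaling, and a step count for it.

Step count: an algorithm is written in the monad `Timed`, which carries a result together with the
number of steps spent on it (unit cost arithmetic).  All elementary operations are wrapped in `step`,
which costs one and stands for at most a fixed number of operations of the following kinds: an
arithmetic operation, a rounding, a maximum, or a comparison of two numbers; a logical connective;
reading an entry of an input table or of an array; building a record or a list cell.  Whole arrays
and lists are only handled entry by entry.  Nothing but taking apart, and branching on, a value
already at hand is free.  For rational `ε` all numbers that occur are rational.
-/

noncomputable section

namespace ServerCloud

/-! ### The scheduling model -/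

/-- The two computational contexts. -/
inductive Loc : Type
  | server : Loc
  | cloud : Loc
  deriving DecidableEq

/-- Processing times on the server and in the cloud, and communication delays.
Only the delays of edges matter. -/
structure Times (n : ℕ) where
  server : Fin n → ℕ
  cloud : Fin n → ℕ∞
  delay : Fin n → Fin n → ℕ

/-- The processing time of job `j` in context `l`. -/
def Times.proc {n : ℕ} (T : Times n) (l : Loc) (j : Fin n) : ℕ∞ :=
  match l with
  | Loc.server => (T.server j : ℕ∞)
  | Loc.cloud => T.cloud j

/-- A problem instance (without the deadline) with `n` jobs: a directed acyclic graph with exactly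
one source and exactly one sink, processing times and communication delays. -/
structure Problem (n : ℕ) where
  edge : Fin n → Fin n → Bool
  source : Fin n
  sink : Fin n
  times : Times n
  acyclic : ∀ j, ¬ Relation.TransGen (fun a b => edge a b = true) j j
  source_iff : ∀ j, (∀ i, edge i j = false) ↔ j = source
  sink_iff : ∀ j, (∀ k, edge j k = false) ↔ j = sink
  server_source : times.server source = 0
  server_sink : times.server sink = 0
  cloud_eq_top_iff : ∀ j, times.cloud j = ⊤ ↔ j = source ∨ j = sink

/-- A schedule: the partition of the jobs into server and cloud jobs, and the completion times. -/
structure Schedule (n : ℕ) where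
  loc : Fin n → Loc
  completion : Fin n → ℕ

namespace Problem

variable {n : ℕ}

/-- The actual processing time of job `j` in `π`. -/
def procIn (I : Problem n) (π : Schedule n) (j : Fin n) : ℕ∞ := I.times.proc (π.loc j) j

/-- The delay between `i` and `j` that has to be respected in `π`. -/
def delayIn (I : Problem n) (π : Schedule n) (i j : Fin n) : ℕ :=
  if π.loc i = π.loc j then 0 else I.times.delay i j

/-- Valid schedules.  The first clause says that no job starts before time `0`; it forces source and
sink onto the server, as their cloud processing time is infinite. -/
structure Valid (I : Problem n) (π : Schedule n) : Prop where
  start_nonneg : ∀ j, I.procIn π j ≤ (π.completion j : ℕ∞)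
  server_disjoint : ∀ i j, i ≠ j → π.loc i = Loc.server → π.loc j = Loc.server →
    (π.completion i : ℕ∞) + I.procIn π j ≤ (π.completion j : ℕ∞) ∨
    (π.completion j : ℕ∞) + I.procIn π i ≤ (π.completion i : ℕ∞)
  precedence : ∀ i j, I.edge i j = true →
    (π.completion i : ℕ∞) + (I.delayIn π i j : ℕ∞) + I.procIn π j ≤ (π.completion j : ℕ∞)

/-- The makespan: the completion time of the sink. -/
def makespan (I : Problem n) (π : Schedule n) : ℕ := π.completion I.sink

/-- The cost: the total time spent processing jobs in the cloud. -/
def cost (I : Problem n) (π : Schedule n) : ℕ∞ :=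
  ∑ j with π.loc j = Loc.cloud, I.times.cloud j

/-- The maximum cardinality of a source and sink dividing cut: the maximum number of edges that
leave a set of jobs containing the source and having no incoming edges. -/
def maxCut (I : Problem n) : ℕ :=
  ({A : Finset (Fin n) | I.source ∈ A ∧ ∀ j k, I.edge j k = true → k ∈ A → j ∈ A} :
      Finset (Finset (Fin n))).sup
    fun A => ({e : Fin n × Fin n | I.edge e.1 e.2 = true ∧ e.1 ∈ A ∧ e.2 ∉ A} :
      Finset (Fin n × Fin n)).card

end Problem

/-! ### Counting steps -/

/-- A result together with the number of elementary steps spent on computing it. -/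
structure Timed (α : Type) where
  val : α
  steps : ℕ

instance : Monad Timed where
  pure a := ⟨a, 0⟩
  bind x f := ⟨(f x.val).val, x.steps + (f x.val).steps⟩

/-- One elementary operation, with result `a`. -/
def step {α : Type} (a : α) : Timed α := ⟨a, 1⟩

/-- Fill an array of length `n`, entry by entry. -/
def tabulate {n : ℕ} {α : Type} (f : Fin n → Timed α) : Timed (Fin n → α) :=
  ⟨fun i => (f i).val, ∑ i, ((f i).steps + 1)⟩

/-- Test a condition for all indices, one after the other. -/
def allOf {n : ℕ} (f : Fin n → Timed Bool) : Timed Bool :=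
  ⟨decide (∀ i, (f i).val = true), ∑ i, ((f i).steps + 1)⟩

/-- Test whether some index satisfies a condition, one after the other. -/
def anyOf {n : ℕ} (f : Fin n → Timed Bool) : Timed Bool :=
  ⟨decide (∃ i, (f i).val = true), ∑ i, ((f i).steps + 1)⟩

/-- Run through a list, updating `b`. -/
def forEach {α β : Type} (body : β → α → Timed β) : β → List α → Timed β
  | b, [] => step b
  | b, a :: l => do
    let b' ← body b a
    let b'' ← step b'
    forEach body b'' l

/-! ### The dynamic program -/

/-- A state of a running schedule: the timestamp, the number of time steps for which the server has
been unused, the open edges `(j, k)` (`j` is processed, `k` is not), and for each job `j` with an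
open edge `(j, k)` its location and the number of time steps since it finished (`none` for all other
jobs). -/
structure State (n : ℕ) where
  time : ℕ
  free : ℕ
  isOpen : Fin n → Fin n → Bool
  info : Fin n → Option (Loc × ℕ)

/-- A member of the state list: a state, its value (the cost), and the processed jobs with their
locations and completion times, the latest first. -/
structure Entry (n : ℕ) where
  state : State n
  value : ℕ∞
  history : List (Fin n × Loc × ℕ)

section DynProg

variable {n : ℕ}

/-- Do the two states agree? -/
def sameState (s s' : State n) : Timed Bool := do
  let a ← step (decide (s.time = s'.time))
  let b ← step (decide (s.free = s'.free))
  let c ← allOf fun j => allOf fun k => step (decide (s.isOpen j k = s'.isOpen j k))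
  let d ← allOf fun j => step (decide (s.info j = s'.info j))
  let ab ← step (a && b)
  let cd ← step (c && d)
  step (ab && cd)

/-- The value of the state `s` in a list, if `s` occurs there. -/
def findValue (s : State n) : List (Entry n) → Timed (Option ℕ∞)
  | [] => step none
  | e :: l => do
    let b ← sameState e.state s
    if b then step (some e.value) else findValue s l

/-- Remove the state `s` from a list. -/
def eraseState (s : State n) : List (Entry n) → Timed (List (Entry n))
  | [] => step []
  | e :: l => do
    let b ← sameState e.state s
    if b then step l else do
      let l' ← eraseState s l
      step (e :: l')

/-- Insert an entry into a list that is sorted by value. -/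
def insertEntry (e : Entry n) : List (Entry n) → Timed (List (Entry n))
  | [] => step [e]
  | x :: l => do
    let b ← step (decide (e.value < x.value))
    if b then step (e :: x :: l) else do
      let l' ← insertEntry e l
      step (x :: l')

/-- Add the entry `e` to a state list whose part up to the state currently inspected is `visited`
and whose remaining part is `rest`.  A state in `visited` has at most the value of `e`, as the list
is sorted; a state in `rest` is updated and moved if the new value is lower. -/
def addEntry (visited : List (Entry n)) (e : Entry n) (rest : List (Entry n)) :
    Timed (List (Entry n)) := do
  let v ← findValue e.state visited
  match v with
  | some _ => step rest
  | none =>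
    let r ← findValue e.state rest
    match r with
    | none => insertEntry e rest
    | some w =>
      let b ← step (decide (e.value < w))
      if b then do
        let rest' ← eraseState e.state rest
        insertEntry e rest'
      else step rest

/-- Is `j` the head of an open edge, and are all its incoming edges open? -/
def ready (I : Problem n) (s : State n) (j : Fin n) : Timed Bool := do
  let a ← anyOf fun k => step (s.isOpen k j)
  let b ← allOf fun k => do
    let x ← step (I.edge k j)
    if x then step (s.isOpen k j) else step true
  step (a && b)

/-- Can `j` be processed in context `l` so that it finishes right now? -/
def fits (I : Problem n) (T : Times n) (s : State n) (j : Fin n) (l : Loc) : Timed Bool := do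
  let p ← step (T.proc l j)
  let a ← match l with
    | Loc.server => step (decide (p ≤ (s.free : ℕ∞)))
    | Loc.cloud => step true
  let b ← allOf fun k => do
    let x ← step (I.edge k j)
    if x then do
      let y ← step (s.info k)
      match y with
      | none => step false
      | some (lk, f) =>
        let same ← step (decide (lk = l))
        if same then step (decide (p ≤ (f : ℕ∞))) else do
          let c ← step (T.delay k j)
          let q ← step (p + (c : ℕ∞))
          step (decide (q ≤ (f : ℕ∞)))
    else step true
  step (a && b)

/-- The state list entry that results from `e` when `j` finishes right now in context `l`; `w j` is
the cost of processing `j` in the cloud. -/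
def extend (I : Problem n) (w : Fin n → ℕ∞) (e : Entry n) (j : Fin n) (l : Loc) :
    Timed (Entry n) := do
  let opened ← tabulate fun a => tabulate fun b => do
    let isTail ← step (decide (a = j))
    if isTail then step (I.edge j b) else do
      let isHead ← step (decide (b = j))
      if isHead then step false else step (e.state.isOpen a b)
  let info ← tabulate fun a => do
    let x ← anyOf fun b => step (opened a b)
    if x then do
      let isJ ← step (decide (a = j))
      if isJ then step (some (l, 0)) else step (e.state.info a)
    else step none
  let hist ← step ((j, l, e.state.time) :: e.history)
  match l with
  | Loc.server => step ⟨⟨e.state.time, 0, opened, info⟩, e.value, hist⟩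
  | Loc.cloud =>
    let v ← step (e.value + w j)
    step ⟨⟨e.state.time, e.state.free, opened, info⟩, v, hist⟩

/-- Add all successors of `e` that process one more job to the remaining state list. -/
def expand (I : Problem n) (T : Times n) (w : Fin n → ℕ∞) (visited : List (Entry n))
    (e : Entry n) (rest : List (Entry n)) : Timed (List (Entry n)) :=
  forEach (fun r j => do
    let b ← ready I e.state j
    if b then
      forEach (fun r' l => do
        let c ← fits I T e.state j l
        if c then do
          let e' ← extend I w e j l
          addEntry visited e' r'
        else step r') r [Loc.server, Loc.cloud]
    else step r) rest (List.finRange n)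

/-- Traverse the state list once, from low to high values, adding successors on the way.  `visited`
is the part already inspected, in reverse order.  The first argument only serves to make the
recursion structural. -/
def traverse (I : Problem n) (T : Times n) (w : Fin n → ℕ∞) :
    ℕ → List (Entry n) → List (Entry n) → Timed (List (Entry n))
  | _, visited, [] => forEach (fun l e => step (e :: l)) [] visited
  | 0, visited, e :: rest => forEach (fun l x => step (x :: l)) (e :: rest) visited
  | fuel + 1, visited, e :: rest => do
    let visited' ← step (e :: visited)
    let rest' ← expand I T w visited' e rest
    traverse I T w fuel visited' rest'

/-- The number of all states with timestamp `t` whose other numbers are at most `t`.  As no state is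
inspected twice, a traversal at time `t` has no more rounds than that. -/
def roundBound (n t : ℕ) : ℕ := (t + 1) * 2 ^ (n * n) * (2 * (t + 1) + 1) ^ n

/-- Move one state from time `t` to time `t + 1`. -/
def advanceEntry (e : Entry n) : Timed (Entry n) := do
  let t ← step (e.state.time + 1)
  let f ← step (e.state.free + 1)
  let opened ← tabulate fun a => tabulate fun b => step (e.state.isOpen a b)
  let info ← tabulate fun a => do
    let x ← step (e.state.info a)
    match x with
    | none => step none
    | some (l, g) =>
      let g' ← step (g + 1)
      step (some (l, g'))
  step ⟨⟨t, f, opened, info⟩, e.value, e.history⟩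

/-- Move the whole state list from time `t` to time `t + 1`. -/
def advance : List (Entry n) → Timed (List (Entry n))
  | [] => step []
  | e :: l => do
    let e' ← advanceEntry e
    let l' ← advance l
    step (e' :: l')

/-- The iteration over the timestamps `t`, `t + 1`, …, `t + r`. -/
def timeLoop (I : Problem n) (T : Times n) (w : Fin n → ℕ∞) :
    ℕ → ℕ → List (Entry n) → Timed (List (Entry n))
  | t, 0, sl => traverse I T w (roundBound n t) [] sl
  | t, r + 1, sl => do
    let sl' ← traverse I T w (roundBound n t) [] sl
    let sl'' ← advance sl'
    let t' ← step (t + 1)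
    timeLoop I T w t' r sl''

/-- The start state, in which only the source is processed, at time `0` on the server. -/
def startEntry (I : Problem n) : Timed (Entry n) := do
  let opened ← tabulate fun a => tabulate fun b => do
    let x ← step (decide (a = I.source))
    if x then step (I.edge a b) else step false
  let info ← tabulate fun a => do
    let x ← anyOf fun b => step (opened a b)
    if x then step (some (Loc.server, 0)) else step none
  let hist ← step [(I.source, Loc.server, 0)]
  step ⟨⟨0, 0, opened, info⟩, 0, hist⟩

/-- The first entry of the list with timestamp `d` and without open edges. -/
def firstFinished (d : ℕ) : List (Entry n) → Timed (Option (Entry n))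
  | [] => step none
  | e :: l => do
    let a ← step (decide (e.state.time = d))
    let b ← anyOf fun j => anyOf fun k => step (e.state.isOpen j k)
    let c ← step (a && !b)
    if c then step (some e) else firstFinished d l

/-- The dynamic program on the task graph of `I`, with processing times and delays `T`, cloud costs
`w` and deadline `d`. -/
def dynProg (I : Problem n) (T : Times n) (w : Fin n → ℕ∞) (d : ℕ) :
    Timed (Option (Entry n)) := do
  let e ← startEntry I
  let sl ← step [e]
  let sl' ← timeLoop I T w 0 d sl
  firstFinished d sl'

end DynProg

/-! ### Scaling -/

section Scaling

variable {n : ℕ}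

/-- Scale a number down by the factor `σ`. -/
def scaleNat (σ : ℝ) (x : ℕ) : Timed ℕ := do
  let q ← step ((x : ℝ) / σ)
  step ⌊q⌋₊

/-- Scale a number or `∞` down by the factor `σ`. -/
def scaleENat (σ : ℝ) (x : ℕ∞) : Timed ℕ∞ := do
  let b ← step (decide (x = ⊤))
  if b then step ⊤ else do
    let y ← scaleNat σ x.toNat
    step (y : ℕ∞)

/-- Scale all processing times and delays down by the factor `σ`. -/
def scaleTimes (σ : ℝ) (T : Times n) : Timed (Times n) := do
  let s ← tabulate fun j => scaleNat σ (T.server j)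
  let c ← tabulate fun j => scaleENat σ (T.cloud j)
  let d ← tabulate fun i => tabulate fun j => scaleNat σ (T.delay i j)
  step ⟨s, c, d⟩

/-- Insert a job, given with its location and start time, into a list sorted by start times, after
all jobs with the same start time. -/
def insertByStart (x : Fin n × Loc × ℕ) :
    List (Fin n × Loc × ℕ) → Timed (List (Fin n × Loc × ℕ))
  | [] => step [x]
  | y :: l => do
    let b ← step (decide (x.2.2 < y.2.2))
    if b then step (x :: y :: l) else do
      let l' ← insertByStart x l
      step (y :: l')

/-- The jobs with their locations and start times, in the order in which they start, from the list
of the jobs with their locations and completion times. -/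
def startOrder (T : Times n) : List (Fin n × Loc × ℕ) → Timed (List (Fin n × Loc × ℕ))
  | [] => step []
  | (j, l, t) :: h => do
    let L ← startOrder T h
    let p ← step (T.proc l j)
    let s ← step (t - p.toNat)
    insertByStart (j, l, s) L

/-- A partially restored schedule: the total delay by which the remaining jobs are shifted, the time
at which the server becomes free, and locations and completion times of the jobs scheduled so far. -/
structure Partial (n : ℕ) where
  shift : ℝ
  serverFree : ℝ
  placed : Fin n → Option (Loc × ℝ)

/-- Schedule the job `j`, which starts at time `s` in the scaled schedule, at time `σ * s` plus the
current shift, or as soon after that as the server is free, its predecessors are finished and their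
communication is done; shift all remaining jobs by the resulting extra delay. -/
def placeJob (I : Problem n) (σ : ℝ) (P : Partial n) (x : Fin n × Loc × ℕ) :
    Timed (Partial n) := do
  let (j, l, s) := x
  let a ← step (σ * (s : ℝ))
  let target ← step (a + P.shift)
  let base ← match l with
    | Loc.server => step (max target P.serverFree)
    | Loc.cloud => step target
  let start ← forEach (fun cur i => do
    let e ← step (I.edge i j)
    if e then do
      let y ← step (P.placed i)
      match y with
      | none => step cur
      | some (li, ci) =>
        let same ← step (decide (li = l))
        if same then step (max cur ci) else do
          let c ← step (I.times.delay i j)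
          let r ← step (ci + (c : ℝ))
          step (max cur r)
    else step cur) base (List.finRange n)
  let Δ ← step (start - target)
  let shift' ← step (P.shift + Δ)
  let p ← step (I.times.proc l j)
  let compl ← step (start + (p.toNat : ℝ))
  let placed' ← tabulate fun i => do
    let b ← step (decide (i = j))
    if b then step (some (l, compl)) else step (P.placed i)
  match l with
  | Loc.server => step ⟨shift', compl, placed'⟩
  | Loc.cloud => step ⟨shift', P.serverFree, placed'⟩

/-- Transform a schedule for the scaled times `T`, given by the list of its jobs with locations and
completion times, into one for `I`.  In the end all completion times are rounded down to
integers. -/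
def restore (I : Problem n) (σ : ℝ) (T : Times n) (h : List (Fin n × Loc × ℕ)) :
    Timed (Schedule n) := do
  let L ← startOrder T h
  let none' ← tabulate fun _ => step none
  let P₀ ← step ⟨0, 0, none'⟩
  let P ← forEach (placeJob I σ) P₀ L
  let loc ← tabulate fun j => do
    let y ← step (P.placed j)
    match y with
    | some (l, _) => step l
    | none => step Loc.server
  let compl ← tabulate fun j => do
    let y ← step (P.placed j)
    match y with
    | some (_, c) => step ⌊c⌋₊
    | none => step 0
  step ⟨loc, compl⟩

/-- The dynamic program combined with scaling: scale times, delays and deadline by the factor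
`σ = ε * d / (2 * n)`, rounding down the times and delays and rounding up the deadline, run the
dynamic program with the original cloud costs, and transform its result. -/
def scaledDynProg (I : Problem n) (d : ℕ) (ε : ℝ) : Timed (Option (Schedule n)) := do
  let a ← step (ε * (d : ℝ))
  let b ← step (2 * (n : ℝ))
  let σ ← step (a / b)
  let T ← scaleTimes σ I.times
  let q ← step ((d : ℝ) / σ)
  let d' ← step ⌈q⌉₊
  let r ← dynProg I T I.times.cloud d'
  match r with
  | none => step none
  | some e =>
    let π ← restore I σ T e.history
    step (some π)

end Scaling

end ServerCloud

end

noncomputable section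

namespace ServerCloud

/-! ### Results and step counts of the elementary constructs -/

section Timed

variable {α β : Type} {n : ℕ}

/-! The dynamic program is exact for the scaled instance, and scaling costs at most a factor 1 + ε
in the makespan and nothing in the cost.

Exactness. Behind every list entry stands a history (`ValidHist`), the jobs in the order in which
they were processed, and `stateOf` computes the state from it. Whether a job can finish now depends
on the state alone (`ValidHist.ready_iff`, `ValidHist.fits_iff`), and so does the resulting state
(`extend_state_congr`). Hence, of two histories with the same state, the cheaper one can replace the
other in every continuation, and one entry per state is enough (`reach_listAfter`). One traversal
per timestamp suffices: a successor never costs less than the entry it comes from, so in a list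
sorted by value the inspected entries are final (`traverse_spec`). Every schedule of the right kind
becomes a history once its jobs are suitably sorted (`exists_history`).

Running time. The processed jobs are closed under predecessors, so the open edges form a cut and
there are at most φ of them. A state is determined by the idle time of the server and by these edges
with the location and elapsed time of their tails, which leaves at most (t+1)(2n²(t+1)+1)^φ states
at time t (`stateBound_of_maxCut`). The scaled deadline is ⌈2n/ε⌉, independent of d, so everything
is polynomial in n and 1/ε for fixed φ.

Scaling. Since ⌊a⌋ + ⌊b⌋ ≤ ⌊a + b⌋, rounding the scaled completion times of a valid schedule down,
with the source moved to time 0, gives a history for the scaled times with the same locations, hence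
the same cost (`exists_scaled_history`). Conversely, a processing time p is at most σ(⌊p/σ⌋ + 1),
and likewise a delay. So each job waits at most 2σ beyond the shift accumulated before it, and the
first one not at all (`Restored.placeJob`). The makespan is at most σ⌈d/σ⌉ + 2σ(n−1) ≤ d + 2nσ =
(1+ε)d. Rounding down at the end is harmless because the original processing times and delays are
integers. -/

@[simp] theorem bind_val (x : Timed α) (f : α → Timed β) : (x >>= f).val = (f x.val).val := (rfl)
@[simp] theorem bind_steps (x : Timed α) (f : α → Timed β) :
    (x >>= f).steps = x.steps + (f x.val).steps := (rfl)
@[simp] theorem step_val (a : α) : (step a).val = a := (rfl)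
@[simp] theorem step_steps (a : α) : (step a).steps = 1 := (rfl)
@[simp] theorem tabulate_val (f : Fin n → Timed α) : (tabulate f).val = fun i => (f i).val := (rfl)
@[simp] theorem allOf_val (f : Fin n → Timed Bool) :
    (allOf f).val = decide (∀ i, (f i).val = true) := (rfl)
@[simp] theorem allOf_steps (f : Fin n → Timed Bool) :
    (allOf f).steps = ∑ i, ((f i).steps + 1) := (rfl)
@[simp] theorem anyOf_val (f : Fin n → Timed Bool) :
    (anyOf f).val = decide (∃ i, (f i).val = true) := (rfl)

@[simp] theorem ite_val (p : Prop) [Decidable p] (x y : Timed α) :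
    (if p then x else y).val = if p then x.val else y.val := apply_ite _ _ _ _

theorem sum_steps_le (f : Fin n → ℕ) {K : ℕ} (h : ∀ i, f i ≤ K) : ∑ i, (f i + 1) ≤ n * (K + 1) := by
  calc ∑ i, (f i + 1) ≤ ∑ _i : Fin n, (K + 1) :=
        Finset.sum_le_sum fun i _ => Nat.add_le_add_right (h i) 1
    _ = n * (K + 1) := by simp

theorem tabulate_steps_le {f : Fin n → Timed α} {K : ℕ} (h : ∀ i, (f i).steps ≤ K) :
    (tabulate f).steps ≤ n * (K + 1) := sum_steps_le _ h

theorem allOf_steps_le {f : Fin n → Timed Bool} {K : ℕ} (h : ∀ i, (f i).steps ≤ K) :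
    (allOf f).steps ≤ n * (K + 1) := sum_steps_le _ h

theorem anyOf_steps_le {f : Fin n → Timed Bool} {K : ℕ} (h : ∀ i, (f i).steps ≤ K) :
    (anyOf f).steps ≤ n * (K + 1) := sum_steps_le _ h

@[simp] theorem forEach_nil (body : β → α → Timed β) (b : β) : forEach body b [] = step b := rfl

@[simp] theorem forEach_cons_val (body : β → α → Timed β) (b : β) (a : α) (l : List α) :
    (forEach body b (a :: l)).val = (forEach body (body b a).val l).val := rfl

theorem forEach_cons_steps (body : β → α → Timed β) (b : β) (a : α) (l : List α) :
    (forEach body b (a :: l)).steps =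
      (body b a).steps + 1 + (forEach body (body b a).val l).steps := by
  simp [forEach, add_assoc]

/-- A loop preserves an invariant `P`, moves along a preorder `R` and achieves for each element `a`
a property `Q a` that is stable under `R`. -/
theorem forEach_spec {body : β → α → Timed β} (P : β → Prop) (R : β → β → Prop) (Q : α → β → Prop)
    (hrefl : ∀ b, R b b) (htrans : ∀ a b c, R a b → R b c → R a c)
    (hQ : ∀ a b c, Q a b → R b c → Q a c) :
    ∀ (l : List α) (b : β),
      (∀ a ∈ l, ∀ b, P b → P (body b a).val ∧ R b (body b a).val ∧ Q a (body b a).val) → P b →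
      P (forEach body b l).val ∧ R b (forEach body b l).val ∧ ∀ a ∈ l, Q a (forEach body b l).val
  | [], b, _, hb => ⟨hb, hrefl b, by simp⟩
  | a :: l, b, hbody, hb => by
    obtain ⟨h1, h2, h3⟩ := hbody a (by simp) b hb
    obtain ⟨g1, g2, g3⟩ := forEach_spec P R Q hrefl htrans hQ l (body b a).val
      (fun x hx => hbody x (by simp [hx])) h1
    refine ⟨g1, htrans _ _ _ h2 g2, fun x hx => ?_⟩
    rcases List.mem_cons.1 hx with rfl | hx
    · exact hQ _ _ _ h3 g2
    · exact g3 x hx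

/-- The invariant `P` is there because the body may be cheap only for accumulators that really
occur, for instance lists of bounded length. Each round pays one step for the rebinding, and the
empty list one more. -/
theorem forEach_steps_le {body : β → α → Timed β} (P : β → Prop) {K : ℕ} :
    ∀ (l : List α) (b : β),
      (∀ a ∈ l, ∀ b, P b → P (body b a).val ∧ (body b a).steps ≤ K) → P b →
      (forEach body b l).steps ≤ l.length * (K + 1) + 1
  | [], b, _, _ => by simp
  | a :: l, b, hbody, hb => by
    obtain ⟨h1, h2⟩ := hbody a (by simp) b hb
    have h3 := forEach_steps_le P l (body b a).val (fun x hx => hbody x (by simp [hx])) h1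
    rw [forEach_cons_steps, List.length_cons, Nat.succ_mul]
    omega

/-- Moving a list onto another one, cell by cell. -/
theorem forEach_push (a : List α) : ∀ l : List α,
    forEach (fun l x => step (x :: l)) a l = ⟨l.reverse ++ a, 2 * l.length + 1⟩ := by
  intro l
  induction l generalizing a with
  | nil => rfl
  | cons x l ih =>
    show Timed.mk _ _ = _
    simp only [ih, step_val, step_steps, bind_val, List.reverse_cons, List.append_assoc,
      List.cons_append, List.nil_append, List.length_cons, bind_steps]
    congr 1
    omega

end Timed

/-! ### State lists -/

section Lists

variable {n : ℕ}

/-- Bracketed like the tests in `sameState`. -/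
theorem State.ext_iff' {s s' : State n} :
    s = s' ↔ (s.time = s'.time ∧ s.free = s'.free) ∧
      (∀ j k, s.isOpen j k = s'.isOpen j k) ∧ ∀ j, s.info j = s'.info j := by
  cases s; cases s'
  simp [funext_iff, and_assoc]

open Classical in
theorem sameState_val (s s' : State n) : (sameState s s').val = decide (s = s') := by
  rw [Bool.eq_iff_iff]
  simp [sameState, State.ext_iff']

theorem sameState_steps (s s' : State n) : (sameState s s').steps = n * (2 * n + 3) + 5 := by
  simp [sameState]
  ring

/-- The state `s` occurs in the list with at most the value `v`. -/
def Reach (l : List (Entry n)) (s : State n) (v : ℕ∞) : Prop :=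
  ∃ y ∈ l, y.state = s ∧ y.value ≤ v

/-- Every state of the first list occurs in the second one, with at most the same value. -/
def Dom (l l' : List (Entry n)) : Prop := ∀ x ∈ l, Reach l' x.state x.value

theorem Dom.refl (l : List (Entry n)) : Dom l l := fun x hx => ⟨x, hx, rfl, le_rfl⟩

theorem Reach.mono {l l' : List (Entry n)} {s : State n} {v : ℕ∞} (h : Reach l s v)
    (hd : Dom l l') : Reach l' s v := by
  obtain ⟨y, hy, rfl, hv⟩ := h
  obtain ⟨z, hz, hs, hv'⟩ := hd y hy
  exact ⟨z, hz, hs, hv'.trans hv⟩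

theorem Dom.trans {l l' l'' : List (Entry n)} (h : Dom l l') (h' : Dom l' l'') : Dom l l'' :=
  fun x hx => (h x hx).mono h'

theorem Dom.append {a a' b b' : List (Entry n)} (h : Dom a a') (h' : Dom b b') :
    Dom (a ++ b) (a' ++ b') := by
  intro x hx
  rcases List.mem_append.1 hx with hx | hx
  · obtain ⟨y, hy, h⟩ := h x hx
    exact ⟨y, List.mem_append_left _ hy, h⟩
  · obtain ⟨y, hy, h⟩ := h' x hx
    exact ⟨y, List.mem_append_right _ hy, h⟩

theorem Dom.of_subset {l l' : List (Entry n)} (h : l ⊆ l') : Dom l l' :=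
  fun x hx => ⟨x, h hx, rfl, le_rfl⟩

theorem findValue_val (s : State n) : ∀ l : List (Entry n),
    ((findValue s l).val = none ∧ s ∉ l.map Entry.state) ∨
    ∃ e ∈ l, e.state = s ∧ (findValue s l).val = some e.value
  | [] => by simp [findValue]
  | e :: l => by
    by_cases h : e.state = s
    · right
      exact ⟨e, by simp, h, by simp [findValue, sameState_val, h]⟩
    · rcases findValue_val s l with ⟨h1, h2⟩ | ⟨x, hx, h1, h2⟩
      · left
        refine ⟨by simp [findValue, sameState_val, h, h1], ?_⟩
        rw [List.map_cons, List.mem_cons, not_or]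
        exact ⟨fun h' => h h'.symm, h2⟩
      · right
        exact ⟨x, by simp [hx], h1, by simp [findValue, sameState_val, h, h2]⟩

theorem findValue_steps_le (s : State n) : ∀ l : List (Entry n),
    (findValue s l).steps ≤ l.length * (n * (2 * n + 3) + 6) + 1
  | [] => by simp [findValue]
  | e :: l => by
    have ih := findValue_steps_le s l
    simp only [findValue, bind_steps, sameState_steps, List.length_cons]
    generalize n * (2 * n + 3) = q at ih ⊢
    rw [Nat.succ_mul]
    split_ifs
    · simp only [step_steps]; omega
    · omega

/-- Only the first occurrence is removed; distinctness of the states makes that the only one. -/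
theorem eraseState_spec (s : State n) : ∀ l : List (Entry n), (l.map Entry.state).Nodup →
    (eraseState s l).val.Sublist l ∧ s ∉ (eraseState s l).val.map Entry.state ∧
      ∀ x ∈ l, x.state = s ∨ x ∈ (eraseState s l).val
  | [], _ => by simp [eraseState]
  | e :: l, hl => by
    rw [List.map_cons, List.nodup_cons] at hl
    by_cases h : e.state = s
    · have hv : (eraseState s (e :: l)).val = l := by simp [eraseState, sameState_val, h]
      rw [hv]
      refine ⟨List.sublist_cons_self _ _, h ▸ hl.1, fun x hx => ?_⟩
      rcases List.mem_cons.1 hx with rfl | hx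
      exacts [.inl h, .inr hx]
    · have hv : (eraseState s (e :: l)).val = e :: (eraseState s l).val := by
        simp [eraseState, sameState_val, h]
      obtain ⟨h1, h2, h3⟩ := eraseState_spec s l hl.2
      rw [hv]
      refine ⟨h1.cons_cons _, ?_, fun x hx => ?_⟩
      · rw [List.map_cons, List.mem_cons, not_or]
        exact ⟨fun h' => h h'.symm, h2⟩
      · rcases List.mem_cons.1 hx with rfl | hx
        · exact .inr (by simp)
        · exact (h3 x hx).imp_right fun h => List.mem_cons_of_mem _ h

theorem eraseState_steps_le (s : State n) : ∀ l : List (Entry n),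
    (eraseState s l).steps ≤ l.length * (n * (2 * n + 3) + 6) + 1
  | [] => by simp [eraseState]
  | e :: l => by
    have ih := eraseState_steps_le s l
    simp only [eraseState, bind_steps, sameState_steps, List.length_cons]
    generalize n * (2 * n + 3) = q at ih ⊢
    rw [Nat.succ_mul]
    split_ifs <;> simp only [bind_steps, step_steps] <;> omega

theorem insertEntry_perm (e : Entry n) : ∀ l : List (Entry n),
    (insertEntry e l).val.Perm (e :: l)
  | [] => by simp [insertEntry]
  | x :: l => by
    by_cases h : e.value < x.value
    · simp [insertEntry, h]
    · have hv : (insertEntry e (x :: l)).val = x :: (insertEntry e l).val := by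
        simp [insertEntry, h]
      rw [hv]
      exact ((insertEntry_perm e l).cons x).trans (List.Perm.swap e x l)

theorem insertEntry_steps_le (e : Entry n) : ∀ l : List (Entry n),
    (insertEntry e l).steps ≤ 2 * l.length + 2
  | [] => by simp [insertEntry]
  | x :: l => by
    have ih := insertEntry_steps_le e l
    simp only [insertEntry, bind_steps, step_steps, List.length_cons]
    split_ifs <;> simp only [bind_steps, step_steps] <;> omega

/-- The list is sorted by value. -/
def SortedByValue (l : List (Entry n)) : Prop := l.Pairwise fun x y => x.value ≤ y.value

theorem SortedByValue.insertEntry (e : Entry n) : ∀ {l : List (Entry n)}, SortedByValue l →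
    SortedByValue (insertEntry e l).val
  | [], _ => by simp [ServerCloud.insertEntry, SortedByValue]
  | x :: l, hl => by
    obtain ⟨h1, h2⟩ := List.pairwise_cons.1 hl
    by_cases h : e.value < x.value
    · have hv : (ServerCloud.insertEntry e (x :: l)).val = e :: x :: l := by
        simp [ServerCloud.insertEntry, h]
      rw [hv]
      refine List.pairwise_cons.2 ⟨fun y hy => ?_, hl⟩
      rcases List.mem_cons.1 hy with rfl | hy
      exacts [h.le, h.le.trans (h1 y hy)]
    · have hv : (ServerCloud.insertEntry e (x :: l)).val =
          x :: (ServerCloud.insertEntry e l).val := by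
        simp [ServerCloud.insertEntry, h]
      rw [hv]
      refine List.pairwise_cons.2 ⟨fun y hy => ?_, SortedByValue.insertEntry e h2⟩
      rcases List.mem_cons.1 ((insertEntry_perm e l).mem_iff.1 hy) with rfl | hy
      exacts [not_lt.1 h, h1 y hy]

/-- What adding an entry does to a state list. -/
theorem addEntry_spec {visited rest : List (Entry n)} {e : Entry n}
    (hnd : ((visited ++ rest).map Entry.state).Nodup) (hs : SortedByValue rest)
    (hv : ∀ x ∈ visited, x.value ≤ e.value) :
    (((visited ++ (addEntry visited e rest).val).map Entry.state).Nodup ∧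
      SortedByValue (addEntry visited e rest).val ∧
      ∀ x ∈ (addEntry visited e rest).val, x ∈ rest ∨ x = e) ∧
    Dom rest (addEntry visited e rest).val ∧
    Reach (visited ++ (addEntry visited e rest).val) e.state e.value := by
  rcases findValue_val e.state visited with ⟨h1, h2⟩ | ⟨x, hx, h1, h2⟩
  swap
  · have : (addEntry visited e rest).val = rest := by simp [addEntry, h2]
    rw [this]
    exact ⟨⟨hnd, hs, fun x hx => .inl hx⟩, Dom.refl _, x, by simp [hx], h1, hv x hx⟩
  rw [List.map_append, List.nodup_append'] at hnd
  obtain ⟨hn1, hn2, hn3⟩ := hnd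
  -- Treats both cases in which `e` is inserted: `l` is `rest`, or `rest` without an entry of the
  -- same state. Whatever is missing from `l` is dominated by `e`.
  have key : ∀ l : List (Entry n), l.Sublist rest → e.state ∉ l.map Entry.state →
      (∀ x ∈ rest, x ∈ l ∨ x.state = e.state ∧ e.value ≤ x.value) →
      (((visited ++ (insertEntry e l).val).map Entry.state).Nodup ∧
      SortedByValue (insertEntry e l).val ∧
      ∀ x ∈ (insertEntry e l).val, x ∈ rest ∨ x = e) ∧
      Dom rest (insertEntry e l).val ∧
      Reach (visited ++ (insertEntry e l).val) e.state e.value := by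
    intro l hl hel hD
    have hp := insertEntry_perm e l
    have he : e ∈ (insertEntry e l).val := hp.mem_iff.2 (by simp)
    refine ⟨⟨?_, SortedByValue.insertEntry e (hs.sublist hl), fun x hx => ?_⟩, fun x hx => ?_,
      e, List.mem_append_right _ he, rfl, le_rfl⟩
    · have hp' := (hp.map Entry.state)
      rw [List.map_append, List.nodup_append']
      refine ⟨hn1, hp'.nodup_iff.2 ?_, fun s hsv hsl => ?_⟩
      · rw [List.map_cons, List.nodup_cons]
        exact ⟨hel, hn2.sublist (hl.map _)⟩
      · have := hp'.mem_iff.1 hsl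
        rw [List.map_cons, List.mem_cons] at this
        rcases this with rfl | this
        · exact h2 hsv
        · exact hn3 hsv ((hl.map _).subset this)
    · rcases List.mem_cons.1 (hp.mem_iff.1 hx) with rfl | hx
      exacts [.inr rfl, .inl (hl.subset hx)]
    · rcases hD x hx with hx | ⟨h, h'⟩
      · exact ⟨x, hp.mem_iff.2 (by simp [hx]), rfl, le_rfl⟩
      · exact ⟨e, he, h.symm, h'⟩
  rcases findValue_val e.state rest with ⟨g1, g2⟩ | ⟨x, hx, g1, g2⟩
  · have : (addEntry visited e rest).val = (insertEntry e rest).val := by simp [addEntry, h1, g1]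
    rw [this]
    exact key rest (List.Sublist.refl _) g2 fun x hx => .inl hx
  · by_cases hlt : e.value < x.value
    · have : (addEntry visited e rest).val = (insertEntry e (eraseState e.state rest).val).val := by
        simp [addEntry, h1, g2, hlt]
      rw [this]
      obtain ⟨k1, k2, k3⟩ := eraseState_spec e.state rest hn2
      refine key _ k1 k2 fun y hy => ?_
      rcases k3 y hy with h | h
      -- The erased entry is the one whose value was compared with that of `e`, as its state occurs
      -- only once.
      · have : y = x := List.inj_on_of_nodup_map hn2 hy hx (h.trans g1.symm)
        exact .inr ⟨h, this ▸ hlt.le⟩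
      · exact .inl h
    · have : (addEntry visited e rest).val = rest := by simp [addEntry, h1, g2, hlt]
      rw [this]
      exact ⟨⟨by rw [List.map_append, List.nodup_append']; exact ⟨hn1, hn2, hn3⟩, hs,
        fun x hx => .inl hx⟩, Dom.refl _, x, by simp [hx], g1, not_lt.1 hlt⟩

theorem eraseState_length_le (s : State n) : ∀ l : List (Entry n),
    (eraseState s l).val.length ≤ l.length
  | [] => by simp [eraseState]
  | e :: l => by
    have ih := eraseState_length_le s l
    simp only [eraseState, bind_val, ite_val, step_val]
    split_ifs <;> simp [ih]

/-- The two searches together read each cell at most once, and erasing reads `rest` once more: twice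
K comparisons of states. Insertion adds two steps per cell. -/
theorem addEntry_steps_le {visited rest : List (Entry n)} {e : Entry n} {K : ℕ}
    (hK : visited.length + rest.length ≤ K) :
    (addEntry visited e rest).steps ≤ 2 * K * (n * (2 * n + 3) + 7) + 6 := by
  have h1 := findValue_steps_le e.state visited
  have h2 := findValue_steps_le e.state rest
  have h3 := eraseState_steps_le e.state rest
  have h4 := insertEntry_steps_le e rest
  have h5 := insertEntry_steps_le e (eraseState e.state rest).val
  have h6 := eraseState_length_le e.state rest
  set q := n * (2 * n + 3) + 6
  have h7 : visited.length * q + rest.length * q ≤ K * q := by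
    rw [← Nat.add_mul]; exact Nat.mul_le_mul_right _ hK
  have h8 : 2 * K * (q + 1) = K * q + K * q + 2 * K := by ring
  show _ ≤ 2 * K * (q + 1) + 6
  rw [h8]
  simp only [addEntry, bind_steps]
  cases (findValue e.state visited).val with
  | some w => simp only [step_steps]; omega
  | none =>
    simp only [bind_steps]
    cases (findValue e.state rest).val with
    | none => simp only; omega
    | some w =>
      simp only [bind_steps, step_steps, step_val]
      cases decide (e.value < w) with
      | true => simp only [if_true, bind_steps]; omega
      | false => simp only [Bool.false_eq_true, if_false, step_steps]; omega

end Lists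

/-! ### Histories of running schedules and their states -/

section History

variable {n : ℕ}

/-- The histories of running schedules: lists of processed jobs with locations and completion times,
the latest first, such that all jobs respect processing times, delays and the server. -/
inductive ValidHist (I : Problem n) (T : Times n) : List (Fin n × Loc × ℕ) → Prop
  | start : ValidHist I T [(I.source, Loc.server, 0)]
  | cons {h : List (Fin n × Loc × ℕ)} {j : Fin n} {l : Loc} {t : ℕ} (valid : ValidHist I T h)
      (new : j ∉ h.map Prod.fst) (pred : ∀ k, I.edge k j = true → k ∈ h.map Prod.fst)
      (le : ∀ x ∈ h, x.2.2 ≤ t)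
      (server : l = Loc.server → ∀ x ∈ h, x.2.1 = Loc.server →
        (x.2.2 : ℕ∞) + T.proc l j ≤ (t : ℕ∞))
      (prec : ∀ x ∈ h, I.edge x.1 j = true →
        (x.2.2 : ℕ∞) + ((if x.2.1 = l then 0 else T.delay x.1 j : ℕ) : ℕ∞) + T.proc l j
          ≤ (t : ℕ∞)) :
      ValidHist I T ((j, l, t) :: h)

/-- The last time at which a server job of the history finished. -/
def lastServer : List (Fin n × Loc × ℕ) → ℕ
  | [] => 0
  | (_, Loc.server, t) :: _ => t
  | (_, Loc.cloud, _) :: h => lastServer h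

/-- The cost of a history. -/
def valueOf (w : Fin n → ℕ∞) : List (Fin n × Loc × ℕ) → ℕ∞
  | [] => 0
  | (_, Loc.server, _) :: h => valueOf w h
  | (j, Loc.cloud, _) :: h => valueOf w h + w j

/-- The state at time `t` of the running schedule with history `h`. -/
def stateOf (I : Problem n) (h : List (Fin n × Loc × ℕ)) (t : ℕ) : State n where
  time := t
  free := t - lastServer h
  isOpen a b := decide (I.edge a b = true ∧ a ∈ h.map Prod.fst ∧ b ∉ h.map Prod.fst)
  info a := if ∃ b, I.edge a b = true ∧ a ∈ h.map Prod.fst ∧ b ∉ h.map Prod.fst then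
    (h.lookup a).map fun p => (p.1, t - p.2) else none

/-- The entry for the history `h` at time `t`. -/
def entryOf (I : Problem n) (w : Fin n → ℕ∞) (h : List (Fin n × Loc × ℕ)) (t : ℕ) : Entry n :=
  ⟨stateOf I h t, valueOf w h, h⟩

variable {I : Problem n} {T : Times n} {w : Fin n → ℕ∞}

/-! ### The task graph, and reading times from a history -/

theorem Problem.edge_irrefl (I : Problem n) (j : Fin n) : I.edge j j = false := by
  by_contra h
  exact I.acyclic j (.single (by simpa using h))

theorem Problem.edge_source (I : Problem n) (i : Fin n) : I.edge i I.source = false :=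
  (I.source_iff I.source).2 rfl i

theorem Problem.exists_pred (I : Problem n) {j : Fin n} (h : j ≠ I.source) :
    ∃ i, I.edge i j = true := by
  by_contra! h'
  exact h ((I.source_iff j).1 fun i => by simpa using h' i)

theorem Problem.exists_succ (I : Problem n) {j : Fin n} (h : j ≠ I.sink) :
    ∃ k, I.edge j k = true := by
  by_contra! h'
  exact h ((I.sink_iff j).1 fun i => by simpa using h' i)

/-- Allows induction from the source along the edges; the swapped version below allows induction
from the sink backwards. -/
theorem Problem.wellFounded_edge (I : Problem n) :
    WellFounded fun a b => Relation.TransGen (fun a b => I.edge a b = true) a b :=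
  haveI : IsTrans (Fin n) (Relation.TransGen fun a b => I.edge a b = true) := inferInstance
  haveI : Std.Irrefl (Relation.TransGen fun a b => I.edge a b = true) := ⟨I.acyclic⟩
  Finite.wellFounded_of_trans_of_irrefl _

theorem Problem.wellFounded_edge_swap (I : Problem n) :
    WellFounded fun a b => Relation.TransGen (fun a b => I.edge a b = true) b a :=
  haveI : IsTrans (Fin n) fun a b => Relation.TransGen (fun a b => I.edge a b = true) b a :=
    ⟨fun _ _ _ h h' => h'.trans h⟩
  haveI : Std.Irrefl fun a b => Relation.TransGen (fun a b => I.edge a b = true) b a :=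
    ⟨I.acyclic⟩
  Finite.wellFounded_of_trans_of_irrefl _

/-- States record elapsed times t − a, whereas histories record the times a themselves. The
hypothesis keeps the truncated subtraction honest. -/
theorem enat_le_sub_iff {p : ℕ∞} {a t : ℕ} (h : a ≤ t) :
    p ≤ ((t - a : ℕ) : ℕ∞) ↔ (a : ℕ∞) + p ≤ (t : ℕ∞) := by
  cases p with
  | top => simp
  | coe p => norm_cast; omega

theorem lookup_eq_some_of_mem {a : Fin n} {v : Loc × ℕ} : ∀ {h : List (Fin n × Loc × ℕ)},
    (h.map Prod.fst).Nodup → (a, v) ∈ h → h.lookup a = some v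
  | [], _, hm => by simp at hm
  | (b, u) :: h, hn, hm => by
    rw [List.map_cons, List.nodup_cons] at hn
    rcases List.mem_cons.1 hm with hm | hm
    · cases hm; simp
    · have : a ≠ b := fun hab => hn.1 (hab ▸ List.mem_map.2 ⟨_, hm, rfl⟩)
      rw [List.lookup_cons, beq_false_of_ne this]
      exact lookup_eq_some_of_mem hn.2 hm

/-! ### What a state reveals about its history -/

namespace ValidHist

theorem nodup {h : List (Fin n × Loc × ℕ)} (hh : ValidHist I T h) : (h.map Prod.fst).Nodup := by
  induction hh with
  | start => simp
  | cons _ hn _ _ _ _ ih => exact List.nodup_cons.2 ⟨hn, ih⟩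

theorem length_le {h : List (Fin n × Loc × ℕ)} (hh : ValidHist I T h) : h.length ≤ n := by
  simpa using hh.nodup.length_le_card

theorem source_mem {h : List (Fin n × Loc × ℕ)} (hh : ValidHist I T h) :
    (I.source, Loc.server, 0) ∈ h := by
  induction hh with
  | start => simp
  | cons _ _ _ _ _ _ ih => simp [ih]

theorem source_mem_map {h : List (Fin n × Loc × ℕ)} (hh : ValidHist I T h) :
    I.source ∈ h.map Prod.fst := List.mem_map.2 ⟨_, hh.source_mem, rfl⟩

/-- Makes the set of processed jobs one of the sets over which `Problem.maxCut` ranges. -/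
theorem pred_mem {h : List (Fin n × Loc × ℕ)} (hh : ValidHist I T h) {j k : Fin n}
    (he : I.edge k j = true) (hj : j ∈ h.map Prod.fst) : k ∈ h.map Prod.fst := by
  induction hh with
  | start =>
    rw [List.map_singleton, List.mem_singleton] at hj
    simp only at hj
    rw [hj, I.edge_source] at he
    cases he
  | cons _ _ hp _ _ _ ih =>
    rw [List.map_cons, List.mem_cons] at hj ⊢
    rcases hj with rfl | hj
    exacts [.inr (hp k he), .inr (ih hj)]

theorem lastServer_mem {h : List (Fin n × Loc × ℕ)} (hh : ValidHist I T h) :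
    ∃ i, (i, Loc.server, lastServer h) ∈ h := by
  induction hh with
  | start => exact ⟨_, List.mem_singleton.2 rfl⟩
  | @cons h j l t _ _ _ _ _ _ ih =>
    cases l with
    | server => exact ⟨j, by simp [lastServer]⟩
    | cloud =>
      obtain ⟨i, hi⟩ := ih
      exact ⟨i, by simp [lastServer, hi]⟩

/-- Histories are ordered by completion times, so the most recent server job is also the last to
finish. -/
theorem le_lastServer {h : List (Fin n × Loc × ℕ)} (hh : ValidHist I T h) :
    ∀ x ∈ h, x.2.1 = Loc.server → x.2.2 ≤ lastServer h := by
  induction hh with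
  | start => simp
  | @cons h j l t _ _ _ hle _ _ ih =>
    intro x hx hs
    rcases List.mem_cons.1 hx with rfl | hx'
    · simp only at hs
      subst hs
      simp [lastServer]
    · cases l with
      | server => exact hle x hx'
      | cloud => exact ih x hx' hs

theorem ne_nil {h : List (Fin n × Loc × ℕ)} (hh : ValidHist I T h) : h ≠ [] := by
  rintro rfl; cases hh

theorem exists_mem {h : List (Fin n × Loc × ℕ)} {k : Fin n} (hk : k ∈ h.map Prod.fst) :
    ∃ v, (k, v) ∈ h := by
  obtain ⟨⟨_, v⟩, hx, rfl⟩ := List.mem_map.1 hk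
  exact ⟨v, hx⟩

/-- Every job but the source has a predecessor. So an unprocessed job whose predecessors are all
processed is the head of an open edge, and the open edges alone decide readiness. -/
theorem ready_iff {h : List (Fin n × Loc × ℕ)} (hh : ValidHist I T h) {t : ℕ} {j : Fin n} :
    (ready I (stateOf I h t) j).val = true ↔
      j ∉ h.map Prod.fst ∧ ∀ k, I.edge k j = true → k ∈ h.map Prod.fst := by
  simp only [ready, bind_val, step_val, anyOf_val, allOf_val, ite_val, Bool.and_eq_true,
    decide_eq_true_eq, stateOf]
  constructor
  · rintro ⟨⟨k, -, -, hj⟩, hall⟩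
    refine ⟨hj, fun k hk => ?_⟩
    have := hall k
    rw [if_pos hk] at this
    simp only [decide_eq_true_eq] at this
    exact this.2.1
  · rintro ⟨hj, hall⟩
    have hjs : j ≠ I.source := fun h' => hj (h' ▸ hh.source_mem_map)
    obtain ⟨k, hk⟩ := I.exists_pred hjs
    refine ⟨⟨k, hk, hall k hk, hj⟩, fun k => ?_⟩
    split_ifs with hk
    · exact decide_eq_true ⟨hk, hall k hk, hj⟩
    · rfl

/-- All edges into `j` are open, so the state still knows location and elapsed time of every
predecessor; among the server jobs only the last one matters. Thus validity of the longer history is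
a property of the state. -/
theorem fits_iff {h : List (Fin n × Loc × ℕ)} (hh : ValidHist I T h) {t : ℕ}
    (ht : ∀ x ∈ h, x.2.2 ≤ t) {j : Fin n} {l : Loc} (hj : j ∉ h.map Prod.fst)
    (hp : ∀ k, I.edge k j = true → k ∈ h.map Prod.fst) :
    (fits I T (stateOf I h t) j l).val = true ↔ ValidHist I T ((j, l, t) :: h) := by
  have hinfo : ∀ k, I.edge k j = true → ∀ v, (k, v) ∈ h →
      (stateOf I h t).info k = some (v.1, t - v.2) := by
    intro k hk v hv
    simp only [stateOf]
    rw [if_pos ⟨j, hk, hp k hk, hj⟩, lookup_eq_some_of_mem hh.nodup hv]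
    rfl
  have hA : (match l with
      | Loc.server => step (decide (T.proc l j ≤ ((stateOf I h t).free : ℕ∞)))
      | Loc.cloud => step true : Timed Bool).val = true ↔
      (l = Loc.server → ∀ x ∈ h, x.2.1 = Loc.server →
        (x.2.2 : ℕ∞) + T.proc l j ≤ (t : ℕ∞)) := by
    cases l with
    | cloud => simp
    | server =>
      obtain ⟨i, hi⟩ := hh.lastServer_mem
      simp only [step_val, forall_const]
      rw [decide_eq_true_iff]
      show T.proc Loc.server j ≤ ((t - lastServer h : ℕ) : ℕ∞) ↔ _
      rw [enat_le_sub_iff (ht _ hi)]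
      refine ⟨fun h' x hx hs => le_trans ?_ h', fun h' => h' _ hi rfl⟩
      gcongr
      exact hh.le_lastServer x hx hs
  have hB : ∀ k, (do
      let x ← step (I.edge k j)
      if x then do
        let y ← step ((stateOf I h t).info k)
        match y with
        | none => step false
        | some (lk, f) =>
          let same ← step (decide (lk = l))
          if same then step (decide (T.proc l j ≤ (f : ℕ∞))) else do
            let c ← step (T.delay k j)
            let q ← step (T.proc l j + (c : ℕ∞))
            step (decide (q ≤ (f : ℕ∞)))
      else step true : Timed Bool).val = true ↔
      ∀ x ∈ h, x.1 = k → I.edge x.1 j = true →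
        (x.2.2 : ℕ∞) + ((if x.2.1 = l then 0 else T.delay x.1 j : ℕ) : ℕ∞) + T.proc l j
          ≤ (t : ℕ∞) := by
    intro k
    by_cases hk : I.edge k j = true
    · obtain ⟨⟨lk, c⟩, hv⟩ := exists_mem (hp k hk)
      have hc : c ≤ t := ht _ hv
      have hR : (∀ x ∈ h, x.1 = k → I.edge x.1 j = true →
          (x.2.2 : ℕ∞) + ((if x.2.1 = l then 0 else T.delay x.1 j : ℕ) : ℕ∞) + T.proc l j
          ≤ (t : ℕ∞)) ↔
          (c : ℕ∞) + ((if lk = l then 0 else T.delay k j : ℕ) : ℕ∞) + T.proc l j ≤ (t : ℕ∞) := by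
        refine ⟨fun h' => h' _ hv rfl hk, ?_⟩
        rintro h' ⟨a, v⟩ hx rfl _
        have := (lookup_eq_some_of_mem hh.nodup hx).symm.trans
          (lookup_eq_some_of_mem hh.nodup hv)
        cases this
        exact h'
      rw [hR]
      simp only [bind_val, step_val, hk, if_true, hinfo k hk _ hv]
      by_cases hl : lk = l
      · simp only [hl, decide_true, if_true, step_val, Nat.cast_zero, add_zero]
        rw [decide_eq_true_iff, enat_le_sub_iff hc]
      · simp only [hl, decide_false, Bool.false_eq_true, if_false, bind_val, step_val,
          decide_eq_true_eq, enat_le_sub_iff hc]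
        rw [add_comm (T.proc l j), add_assoc]
    · simp only [bind_val, step_val, hk]
      simp only [Bool.false_eq_true, if_false, step_val, true_iff]
      rintro x - rfl h'
      exact absurd h' hk
  have hfits : (fits I T (stateOf I h t) j l).val = true ↔
      (l = Loc.server → ∀ x ∈ h, x.2.1 = Loc.server →
        (x.2.2 : ℕ∞) + T.proc l j ≤ (t : ℕ∞)) ∧
      ∀ k, ∀ x ∈ h, x.1 = k → I.edge x.1 j = true →
        (x.2.2 : ℕ∞) + ((if x.2.1 = l then 0 else T.delay x.1 j : ℕ) : ℕ∞) + T.proc l j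
          ≤ (t : ℕ∞) := by
    rw [← hA, ← forall_congr' hB]
    cases l <;>
      simp only [fits, bind_val, step_val, allOf_val, Bool.and_eq_true, decide_eq_true_eq]
  rw [hfits]
  constructor
  · rintro ⟨h1, h2⟩
    exact .cons hh hj hp ht h1 fun x hx he => h2 _ x hx rfl he
  · intro hc
    cases hc with
    -- The tail would be the empty list, which is not a history.
    | start => cases hh
    | cons _ _ _ _ h1 h2 => exact ⟨h1, fun _ x hx _ he => h2 x hx he⟩

theorem extend_val {h : List (Fin n × Loc × ℕ)} (hh : ValidHist I T h) {t : ℕ} {j : Fin n} {l : Loc}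
    (hj : j ∉ h.map Prod.fst) :
    (extend I w (entryOf I w h t) j l).val = entryOf I w ((j, l, t) :: h) t := by
  have hO : ∀ a b, (if a = j then I.edge j b else if b = j then false else
      (stateOf I h t).isOpen a b) = (stateOf I ((j, l, t) :: h) t).isOpen a b := by
    intro a b
    rw [Bool.eq_iff_iff]
    simp only [stateOf, List.map_cons, List.mem_cons, decide_eq_true_eq]
    by_cases ha : a = j
    · subst ha
      simp only [if_true, true_or, true_and]
      refine ⟨fun he => ⟨he, ?_⟩, fun he => he.1⟩
      rintro (rfl | hb)
      · simp [I.edge_irrefl] at he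
      -- A processed successor of `j` would have required `j` to be processed.
      · exact hj (hh.pred_mem he hb)
    · by_cases hb : b = j <;> simp [ha, hb]
  have hI : ∀ a, (if ∃ b, (stateOf I ((j, l, t) :: h) t).isOpen a b = true then
      if a = j then some (l, 0) else (stateOf I h t).info a else none) =
      (stateOf I ((j, l, t) :: h) t).info a := by
    intro a
    simp only [stateOf, decide_eq_true_eq]
    split_ifs with h1 h2 h3
    · subst h2; simp
    · rw [List.lookup_cons, beq_false_of_ne h2]
    -- A tail other than `j` that has an open edge now had the same open edge before.
    · obtain ⟨b, hb1, hb2, hb3⟩ := h1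
      refine absurd ⟨b, hb1, ?_, ?_⟩ h3
      · simpa [h2] using hb2
      · intro hb; exact hb3 (List.mem_cons_of_mem _ hb)
    · rfl
  cases l <;>
  · simp only [extend, bind_val, tabulate_val, step_val, anyOf_val, ite_val, decide_eq_true_eq,
      entryOf] at hO hI ⊢
    simp only [hO, hI]
    congr 1
    all_goals exact State.ext_iff'.2 ⟨⟨rfl, by simp [stateOf, lastServer]⟩, fun _ _ => rfl, fun _ => rfl⟩

/-- Since no job of the history finishes after `t`, every truncated difference grows by exactly one.
-/
theorem advance_val {h : List (Fin n × Loc × ℕ)} (hh : ValidHist I T h) {t : ℕ}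
    (ht : ∀ x ∈ h, x.2.2 ≤ t) :
    (advanceEntry (entryOf I w h t)).val = entryOf I w h (t + 1) := by
  have hI : ∀ a, (match (stateOf I h t).info a with
      | none => step none
      | some (l, g) => do
        let g' ← step (g + 1)
        step (some (l, g')) : Timed (Option (Loc × ℕ))).val = (stateOf I h (t + 1)).info a := by
    intro a
    simp only [stateOf]
    split_ifs with h1
    · obtain ⟨b, -, ha, -⟩ := h1
      obtain ⟨v, hv⟩ := exists_mem ha
      have := ht _ hv
      simp only at this
      rw [lookup_eq_some_of_mem hh.nodup hv]
      simp only [Option.map_some, bind_val, step_val]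
      congr 2
      omega
    · rfl
  obtain ⟨i, hi⟩ := hh.lastServer_mem
  have hF : t - lastServer h + 1 = t + 1 - lastServer h := by
    have := ht _ hi
    simp only at this
    omega
  simp only [advanceEntry, bind_val, tabulate_val, step_val, entryOf]
  congr 1
  refine State.ext_iff'.2 ⟨⟨rfl, hF⟩, fun _ _ => rfl, fun a => ?_⟩
  exact hI a

end ValidHist

theorem startEntry_val (w : Fin n → ℕ∞) :
    (startEntry I).val = entryOf I w [(I.source, Loc.server, 0)] 0 := by
  have hO : ∀ a b, (if a = I.source then I.edge a b else false) =
      (stateOf I [(I.source, Loc.server, 0)] 0).isOpen a b := by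
    intro a b
    rw [Bool.eq_iff_iff]
    by_cases ha : a = I.source
    · subst ha
      simp only [stateOf, if_true, List.map_singleton, List.mem_singleton, true_and,
        decide_eq_true_eq]
      refine ⟨fun he => ⟨he, ?_⟩, fun he => he.1⟩
      rintro rfl
      simp [I.edge_irrefl] at he
    · simp [stateOf, ha]
  have hI : ∀ a, (if ∃ b, (stateOf I [(I.source, Loc.server, 0)] 0).isOpen a b = true then
      some (Loc.server, 0) else none) = (stateOf I [(I.source, Loc.server, 0)] 0).info a := by
    intro a
    simp only [stateOf, decide_eq_true_eq]
    split_ifs with h1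
    · obtain ⟨b, -, ha, -⟩ := h1
      rw [List.map_singleton, List.mem_singleton] at ha
      simp only at ha
      subst ha
      simp
    · rfl
  simp only [startEntry, bind_val, tabulate_val, step_val, anyOf_val, ite_val, decide_eq_true_eq,
      entryOf] at hO hI ⊢
  simp only [hO, hI]
  rfl

/-! Step counts. -/

theorem ready_steps_le (s : State n) (j : Fin n) : (ready I s j).steps ≤ 5 * n + 1 := by
  have h1 : (anyOf fun k => step (s.isOpen k j)).steps ≤ n * (1 + 1) :=
    anyOf_steps_le fun _ => le_rfl
  have h2 : (allOf fun k => do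
      let x ← step (I.edge k j)
      if x then step (s.isOpen k j) else step true).steps ≤ n * (2 + 1) :=
    allOf_steps_le fun k => by
      simp only [bind_steps, step_steps, step_val]
      split_ifs <;> simp
  simp only [ready, bind_steps, step_steps] at h1 h2 ⊢
  omega

theorem fits_steps_le (s : State n) (j : Fin n) (l : Loc) : (fits I T s j l).steps ≤ 7 * n + 3 := by
  have h2 : (allOf fun k => do
      let x ← step (I.edge k j)
      if x then do
        let y ← step (s.info k)
        match y with
        | none => step false
        | some (lk, f) =>
          let same ← step (decide (lk = l))
          if same then step (decide (T.proc l j ≤ (f : ℕ∞))) else do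
            let c ← step (T.delay k j)
            let q ← step (T.proc l j + (c : ℕ∞))
            step (decide (q ≤ (f : ℕ∞)))
      else step true).steps ≤ n * (6 + 1) :=
    allOf_steps_le fun k => by
      simp only [bind_steps, step_steps, step_val]
      split_ifs
      · cases s.info k with
        | none => simp
        | some v =>
          simp only [bind_steps, step_steps, step_val]
          split_ifs <;> simp
      · simp
  have h3 : (fits I T s j l).steps ≤ 1 + (1 + (n * (6 + 1) + 1)) := by
    cases l <;>
      exact Nat.add_le_add_left (Nat.add_le_add_left (Nat.add_le_add_right h2 1) 1) 1
  omega

theorem extend_steps_le (e : Entry n) (j : Fin n) (l : Loc) :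
    (extend I w e j l).steps ≤ 6 * n ^ 2 + 4 * n + 3 := by
  have h1 : (tabulate fun a => tabulate fun b => do
    let isTail ← step (decide (a = j))
    if isTail then step (I.edge j b) else do
      let isHead ← step (decide (b = j))
      if isHead then step false else step (e.state.isOpen a b)).steps ≤ n * (n * (3 + 1) + 1) :=
    tabulate_steps_le fun a => tabulate_steps_le fun b => by
      simp only [bind_steps, step_steps, step_val]
      split_ifs
      · simp
      · simp only [bind_steps, step_steps, step_val]
        split_ifs <;> simp
  have h2 : ∀ o : Fin n → Fin n → Bool, (tabulate fun a => do
    let x ← anyOf fun b => step (o a b)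
    if x then do
      let isJ ← step (decide (a = j))
      if isJ then step (some (l, 0)) else step (e.state.info a)
    else step none).steps ≤ n * ((n * (1 + 1) + 2) + 1) := fun o =>
    tabulate_steps_le fun a => by
      rw [bind_steps]
      refine Nat.add_le_add (anyOf_steps_le fun _ => le_rfl) ?_
      split_ifs
      · simp only [bind_steps, step_steps, step_val]
        split_ifs <;> simp
      · simp
  have h3 := h2 (tabulate fun a => tabulate fun b => do
    let isTail ← step (decide (a = j))
    if isTail then step (I.edge j b) else do
      let isHead ← step (decide (b = j))
      if isHead then step false else step (e.state.isOpen a b)).val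
  have h4 : n * (n * (3 + 1) + 1) + n * ((n * (1 + 1) + 2) + 1) = 6 * n ^ 2 + 4 * n := by ring
  cases l <;> (simp only [extend, bind_steps, step_steps] at h1 h3 ⊢; omega)

theorem advanceEntry_steps_le (e : Entry n) :
    (advanceEntry e).steps ≤ 2 * n ^ 2 + 5 * n + 3 := by
  have h1 : (tabulate fun a => tabulate fun b => step (e.state.isOpen a b)).steps ≤
      n * (n * (1 + 1) + 1) := tabulate_steps_le fun a => tabulate_steps_le fun b => le_rfl
  have h2 : (tabulate fun a => do
    let x ← step (e.state.info a)
    match x with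
    | none => step none
    | some (l, g) =>
      let g' ← step (g + 1)
      step (some (l, g'))).steps ≤ n * (3 + 1) :=
    tabulate_steps_le fun a => by
      simp only [bind_steps, step_steps, step_val]
      cases e.state.info a <;> simp
  have h4 : n * (n * (1 + 1) + 1) + n * (3 + 1) = 2 * n ^ 2 + 5 * n := by ring
  have h3 : (advanceEntry e).steps ≤ 1 + (1 + (n * (n * (1 + 1) + 1) + (n * (3 + 1) + 1))) :=
    Nat.add_le_add_left (Nat.add_le_add_left (Nat.add_le_add h1 (Nat.add_le_add_right h2 1)) 1) 1
  omega

theorem startEntry_steps_le : (startEntry I).steps ≤ 5 * n ^ 2 + 3 * n + 2 := by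
  have h1 : (tabulate fun a => tabulate fun b => do
    let x ← step (decide (a = I.source))
    if x then step (I.edge a b) else step false).steps ≤ n * (n * (2 + 1) + 1) :=
    tabulate_steps_le fun a => tabulate_steps_le fun b => by
      simp only [bind_steps, step_steps, step_val]
      split_ifs <;> simp
  have h2 : ∀ o : Fin n → Fin n → Bool, (tabulate fun a => do
    let x ← anyOf fun b => step (o a b)
    if x then step (some (Loc.server, 0)) else step none).steps ≤ n * ((n * (1 + 1) + 1) + 1) :=
    fun o => tabulate_steps_le fun a => by
      rw [bind_steps]
      refine Nat.add_le_add (anyOf_steps_le fun _ => le_rfl) ?_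
      split_ifs <;> simp
  have h3 := h2 (tabulate fun a => tabulate fun b => do
    let x ← step (decide (a = I.source))
    if x then step (I.edge a b) else step false).val
  have h4 : n * (n * (2 + 1) + 1) + n * ((n * (1 + 1) + 1) + 1) = 5 * n ^ 2 + 3 * n := by ring
  simp only [startEntry, bind_steps, step_steps] at h1 h3 ⊢
  omega

theorem firstFinished_steps_le (d : ℕ) : ∀ l : List (Entry n),
    (firstFinished d l).steps ≤ l.length * (n * (2 * n + 1) + 3) + 1
  | [] => by simp [firstFinished]
  | e :: l => by
    have ih := firstFinished_steps_le d l
    have h1 : (anyOf fun j => anyOf fun k => step (e.state.isOpen j k)).steps ≤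
        n * (n * (1 + 1) + 1) := anyOf_steps_le fun a => anyOf_steps_le fun b => le_rfl
    rw [show n * (n * (1 + 1) + 1) = n * (2 * n + 1) by ring] at h1
    simp only [firstFinished, bind_steps, step_steps, List.length_cons] at h1 ⊢
    generalize n * (2 * n + 1) = q at h1 ih ⊢
    rw [Nat.succ_mul]
    split_ifs
    · simp only [step_steps]; omega
    · omega

end History

/-! ### Traversal of the state list and iteration over the timestamps -/

section Traversal

variable {n : ℕ} {I : Problem n} {T : Times n} {w : Fin n → ℕ∞} {t : ℕ}

/-- The entry comes from the history of a running schedule at time `t`. -/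
def GoodEntry (I : Problem n) (T : Times n) (w : Fin n → ℕ∞) (t : ℕ) (e : Entry n) : Prop :=
  e = entryOf I w e.history t ∧ ValidHist I T e.history ∧ ∀ x ∈ e.history, x.2.2 ≤ t

/-- A sorted list of entries for running schedules at time `t`, without repeated states. -/
structure GoodList (I : Problem n) (T : Times n) (w : Fin n → ℕ∞) (t : ℕ) (l : List (Entry n)) :
    Prop where
  nodup : (l.map Entry.state).Nodup
  sorted : SortedByValue l
  good : ∀ e ∈ l, GoodEntry I T w t e

/-- There are at most `L` states of running schedules at time `t`. -/
def StateBound (I : Problem n) (T : Times n) (w : Fin n → ℕ∞) (t L : ℕ) : Prop :=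
  ∀ l : List (Entry n), (l.map Entry.state).Nodup → (∀ e ∈ l, GoodEntry I T w t e) → l.length ≤ L

/-- All ways to process one more job after `x` at time `t` are represented in the list. -/
def Succeeded (I : Problem n) (T : Times n) (w : Fin n → ℕ∞) (t : ℕ) (l : List (Entry n))
    (x : Entry n) : Prop :=
  ∀ j k, ValidHist I T ((j, k, t) :: x.history) →
    Reach l (stateOf I ((j, k, t) :: x.history) t) (valueOf w ((j, k, t) :: x.history))

/-- Costs are nonnegative; this is what keeps the inspected part of a sorted list final. -/
theorem valueOf_le_cons (h : List (Fin n × Loc × ℕ)) (x : Fin n × Loc × ℕ) :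
    valueOf w h ≤ valueOf w (x :: h) := by
  obtain ⟨j, l, t⟩ := x
  cases l
  · exact le_rfl
  · exact le_self_add

theorem ValidHist.new_pred {h : List (Fin n × Loc × ℕ)} {j : Fin n} {l : Loc} {t : ℕ}
    (hh : ValidHist I T ((j, l, t) :: h)) (hne : h ≠ []) :
    j ∉ h.map Prod.fst ∧ ∀ k, I.edge k j = true → k ∈ h.map Prod.fst := by
  cases hh with
  | start => exact absurd rfl hne
  | cons _ h1 h2 => exact ⟨h1, h2⟩

/-- The invariant of the loops that expand the entry `e`. -/
structure ExpandInv (I : Problem n) (T : Times n) (w : Fin n → ℕ∞) (t : ℕ)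
    (visited : List (Entry n)) (e : Entry n) (r : List (Entry n)) : Prop where
  nodup : ((visited ++ r).map Entry.state).Nodup
  sorted : SortedByValue r
  good : ∀ x ∈ r, GoodEntry I T w t x ∧ e.value ≤ x.value

/-- By `ValidHist.fits_iff` the test succeeds exactly if the longer history is valid. Its value is
at least that of `e`, hence of all visited entries, which is what `addEntry_spec` requires. -/
theorem expand_inner_spec {visited r : List (Entry n)} {e : Entry n} {j : Fin n} (k : Loc)
    (he : GoodEntry I T w t e) (hle : ∀ x ∈ visited, x.value ≤ e.value)
    (hj : j ∉ e.history.map Prod.fst)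
    (hp : ∀ i, I.edge i j = true → i ∈ e.history.map Prod.fst)
    (hr : ExpandInv I T w t visited e r) :
    let r' := (do
        let c ← fits I T e.state j k
        if c then do
          let e' ← extend I w e j k
          addEntry visited e' r
        else step r : Timed (List (Entry n))).val
    ExpandInv I T w t visited e r' ∧ Dom r r' ∧
      (ValidHist I T ((j, k, t) :: e.history) →
        Reach (visited ++ r') (stateOf I ((j, k, t) :: e.history) t)
          (valueOf w ((j, k, t) :: e.history))) := by
  obtain ⟨h1, h2, h3⟩ := he
  have hs : e.state = stateOf I e.history t := congrArg Entry.state h1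
  have hv : e.value = valueOf w e.history := congrArg Entry.value h1
  have hf := h2.fits_iff h3 (l := k) hj hp
  rw [← hs] at hf
  by_cases hc : (fits I T e.state j k).val = true
  · have hvalid := hf.1 hc
    have hx : (extend I w e j k).val = entryOf I w ((j, k, t) :: e.history) t := by
      conv_lhs => rw [h1]
      exact h2.extend_val hj
    simp only [bind_val, hc, if_true, hx]
    have hle' : e.value ≤ (entryOf I w ((j, k, t) :: e.history) t).value := by
      rw [hv]; exact valueOf_le_cons _ _
    obtain ⟨⟨g1, g2, g3⟩, g4, g5⟩ := addEntry_spec hr.nodup hr.sorted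
      (fun x hx => (hle x hx).trans hle')
    refine ⟨⟨g1, g2, fun x hx => ?_⟩, g4, fun _ => g5⟩
    rcases g3 x hx with hx | rfl
    · exact hr.good x hx
    · refine ⟨⟨rfl, hvalid, fun y hy => ?_⟩, hle'⟩
      rcases List.mem_cons.1 hy with rfl | hy
      exacts [le_rfl, h3 y hy]
  · simp only [bind_val, hc, Bool.false_eq_true, if_false, step_val]
    exact ⟨hr, Dom.refl _, fun h => absurd (hf.2 h) hc⟩

theorem expand_inner_steps {visited r : List (Entry n)} {e : Entry n} {j : Fin n} (k : Loc)
    {L : ℕ} (hL : visited.length + r.length ≤ L) :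
    (do
        let c ← fits I T e.state j k
        if c then do
          let e' ← extend I w e j k
          addEntry visited e' r
        else step r : Timed (List (Entry n))).steps ≤
      2 * L * (n * (2 * n + 3) + 7) + 6 * n ^ 2 + 11 * n + 12 := by
  have h1 := fits_steps_le (I := I) (T := T) e.state j k
  have h2 := extend_steps_le (I := I) (w := w) e j k
  have h3 := addEntry_steps_le (e := (extend I w e j k).val) hL
  rw [bind_steps]
  generalize 2 * L * (n * (2 * n + 3) + 7) = q at h3 ⊢
  split_ifs
  · rw [bind_steps]; omega
  · rw [step_steps]; omega

/-- Distinct states turn a bound on the number of states into a bound on the list length at every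
moment, and so on the cost of each list operation. -/
theorem ExpandInv.length_le {visited r : List (Entry n)} {e : Entry n} {L : ℕ}
    (hL : StateBound I T w t L) (hg : ∀ x ∈ visited, GoodEntry I T w t x)
    (hr : ExpandInv I T w t visited e r) : visited.length + r.length ≤ L := by
  have := hL (visited ++ r) hr.nodup fun x hx => by
    rcases List.mem_append.1 hx with hx | hx
    exacts [hg x hx, (hr.good x hx).1]
  simpa using this

/-- A bound for the number of steps that it takes to expand an entry, if there are at most `L`
states. -/
def expandBound (n L : ℕ) : ℕ :=
  n * (5 * n + 1 + (2 * (2 * L * (n * (2 * n + 3) + 7) + 6 * n ^ 2 + 11 * n + 12 + 1) + 1) + 1) + 1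

/-- Correctness and step count come together since the count needs the invariant. A successor once
represented remains so: the visited part is untouched, and the rest changes only along `Dom`. -/
theorem expand_spec {visited r : List (Entry n)} {e : Entry n}
    (hg : ∀ x ∈ visited, GoodEntry I T w t x) (he : GoodEntry I T w t e)
    (hle : ∀ x ∈ visited, x.value ≤ e.value) (hr : ExpandInv I T w t visited e r) :
    (ExpandInv I T w t visited e (expand I T w visited e r).val ∧
      Dom r (expand I T w visited e r).val ∧
      Succeeded I T w t (visited ++ (expand I T w visited e r).val) e) ∧
    ∀ L, StateBound I T w t L → (expand I T w visited e r).steps ≤ expandBound n L := by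
  have hready := fun j => he.2.1.ready_iff (t := t) (j := j)
  rw [← show e.state = stateOf I e.history t from congrArg Entry.state he.1] at hready
  have houter : ∀ j, ∀ b, ExpandInv I T w t visited e b →
      let b' := (do
        let c ← ready I e.state j
        if c then
          forEach (fun r' l => do
            let c ← fits I T e.state j l
            if c then do
              let e' ← extend I w e j l
              addEntry visited e' r'
            else step r') b [Loc.server, Loc.cloud]
        else step b : Timed (List (Entry n)))
      (ExpandInv I T w t visited e b'.val ∧ Dom b b'.val ∧
      ∀ k, ValidHist I T ((j, k, t) :: e.history) →
        Reach (visited ++ b'.val) (stateOf I ((j, k, t) :: e.history) t)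
          (valueOf w ((j, k, t) :: e.history))) ∧
      ∀ L, StateBound I T w t L → b'.steps ≤
        5 * n + 1 + (2 * (2 * L * (n * (2 * n + 3) + 7) + 6 * n ^ 2 + 11 * n + 12 + 1) + 1) := by
    intro j b hb
    simp only [bind_val, bind_steps]
    have hrs := ready_steps_le (I := I) e.state j
    by_cases hc : (ready I e.state j).val = true
    · obtain ⟨hj, hp⟩ := (hready j).1 hc
      simp only [hc, if_true]
      refine ⟨?_, fun L hL => Nat.add_le_add hrs ?_⟩
      · obtain ⟨g1, g2, g3⟩ := forEach_spec (body := fun r' l => do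
            let c ← fits I T e.state j l
            if c then do
              let e' ← extend I w e j l
              addEntry visited e' r'
            else step r') (ExpandInv I T w t visited e) Dom
          (fun k b => ValidHist I T ((j, k, t) :: e.history) →
            Reach (visited ++ b) (stateOf I ((j, k, t) :: e.history) t)
              (valueOf w ((j, k, t) :: e.history)))
          Dom.refl (fun _ _ _ => Dom.trans)
          (fun _ _ _ h hd hv => (h hv).mono ((Dom.refl _).append hd)) [Loc.server, Loc.cloud] b
          (fun k _ b hb => expand_inner_spec k he hle hj hp hb) hb
        refine ⟨g1, g2, fun k => g3 k ?_⟩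
        cases k <;> simp
      · exact forEach_steps_le (body := fun r' l => do
            let c ← fits I T e.state j l
            if c then do
              let e' ← extend I w e j l
              addEntry visited e' r'
            else step r') (ExpandInv I T w t visited e) [Loc.server, Loc.cloud] b
          (fun k _ b hb => ⟨(expand_inner_spec k he hle hj hp hb).1,
            expand_inner_steps k (hb.length_le hL hg)⟩) hb
    · simp only [hc, Bool.false_eq_true, if_false, step_val, step_steps]
      refine ⟨⟨hb, Dom.refl _, fun k hv => ?_⟩, fun L _ => by omega⟩
      refine absurd ((hready j).2 ?_) hc
      exact hv.new_pred he.2.1.ne_nil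
  constructor
  · obtain ⟨g1, g2, g3⟩ := forEach_spec (ExpandInv I T w t visited e) Dom
      (fun j b => ∀ k, ValidHist I T ((j, k, t) :: e.history) →
        Reach (visited ++ b) (stateOf I ((j, k, t) :: e.history) t)
          (valueOf w ((j, k, t) :: e.history)))
      Dom.refl (fun _ _ _ => Dom.trans)
      (fun _ _ _ h hd k hv => (h k hv).mono ((Dom.refl _).append hd)) (List.finRange n) r
      (fun j _ b hb => (houter j b hb).1) hr
    exact ⟨g1, g2, fun j k hv => g3 j (List.mem_finRange j) k hv⟩
  · intro L hL
    have := forEach_steps_le (ExpandInv I T w t visited e) (List.finRange n) r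
      (fun j _ b hb => ⟨(houter j b hb).1.1, (houter j b hb).2 L hL⟩) hr
    rw [List.length_finRange] at this
    exact this

/-- A bound for the number of steps of one traversal, if there are at most `L` states. -/
def traverseBound (n L : ℕ) : ℕ := L * (expandBound n L + 1) + 2 * L + 1

theorem traverse_nil (fuel : ℕ) (visited : List (Entry n)) :
    traverse I T w fuel visited [] = ⟨visited.reverse, 2 * visited.length + 1⟩ := by
  have := forEach_push (α := Entry n) [] visited
  rw [List.append_nil] at this
  cases fuel <;> rw [traverse, this]

/-- Each round moves one entry to `visited`, and no state is repeated. So `visited` never outgrows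
the number of states: the fuel does not run out early, and at most `L - visited.length` rounds
remain. -/
theorem traverse_spec_aux (hR : StateBound I T w t (roundBound n t)) :
    ∀ (fuel : ℕ) (visited rest : List (Entry n)),
      GoodList I T w t (visited.reverse ++ rest) →
      (∀ x ∈ visited, Succeeded I T w t (visited ++ rest) x) →
      roundBound n t ≤ visited.length + fuel →
      (GoodList I T w t (traverse I T w fuel visited rest).val ∧
        Dom (visited ++ rest) (traverse I T w fuel visited rest).val ∧
        ∀ x ∈ (traverse I T w fuel visited rest).val,
          Succeeded I T w t (traverse I T w fuel visited rest).val x) ∧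
      ∀ L, StateBound I T w t L → (traverse I T w fuel visited rest).steps ≤
        (L - visited.length) * (expandBound n L + 1) + 2 * L + 1 := by
  intro fuel
  induction fuel with
  | zero =>
    intro visited rest hl hv hf
    cases rest with
    | cons e rest =>
      -- Without fuel `visited` already has `roundBound n t` entries, and `e` would be one too many.
      have := hR _ hl.nodup hl.good
      simp only [List.length_append, List.length_reverse, List.length_cons] at this
      omega
    | nil =>
      rw [traverse_nil]
      rw [List.append_nil] at hl hv ⊢
      have hd : Dom visited visited.reverse := Dom.of_subset fun x hx => by simpa using hx
      refine ⟨⟨hl, hd, fun x hx j k hjk => ((hv x (by simpa using hx)) j k hjk).mono hd⟩,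
        fun L hL => ?_⟩
      have := hL _ hl.nodup hl.good
      rw [List.length_reverse] at this
      simp only
      omega
  | succ fuel ih =>
    intro visited rest hl hv hf
    cases rest with
    | nil =>
      rw [traverse_nil]
      rw [List.append_nil] at hl hv ⊢
      have hd : Dom visited visited.reverse := Dom.of_subset fun x hx => by simpa using hx
      refine ⟨⟨hl, hd, fun x hx j k hjk => ((hv x (by simpa using hx)) j k hjk).mono hd⟩,
        fun L hL => ?_⟩
      have := hL _ hl.nodup hl.good
      rw [List.length_reverse] at this
      simp only
      omega
    | cons e rest =>
      have hperm : (visited.reverse ++ e :: rest).Perm ((e :: visited) ++ rest) :=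
        List.perm_middle.trans ((List.reverse_perm visited).append_right rest |>.cons e)
      obtain ⟨hs1, hs2, hs3⟩ := List.pairwise_append.1 hl.sorted
      obtain ⟨hs4, hs5⟩ := List.pairwise_cons.1 hs2
      have hle : ∀ x ∈ e :: visited, x.value ≤ e.value := by
        intro x hx
        rcases List.mem_cons.1 hx with rfl | hx
        exacts [le_rfl, hs3 x (by simpa using hx) e (by simp)]
      have hg : ∀ x ∈ e :: visited, GoodEntry I T w t x := fun x hx =>
        hl.good x (hperm.mem_iff.2 (List.mem_append_left _ hx))
      have hinv : ExpandInv I T w t (e :: visited) e rest :=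
        ⟨(hperm.map Entry.state).nodup_iff.1 hl.nodup, hs5, fun x hx =>
          ⟨hl.good x (hperm.mem_iff.2 (List.mem_append_right _ hx)), hs4 x hx⟩⟩
      obtain ⟨⟨g1, g2, g3⟩, g4⟩ := expand_spec hg (hg e (by simp)) hle hinv
      set r := (expand I T w (e :: visited) e rest).val with hr
      have hval : (traverse I T w (fuel + 1) visited (e :: rest)).val =
          (traverse I T w fuel (e :: visited) r).val := by
        simp [traverse, hr]
      have hsteps : (traverse I T w (fuel + 1) visited (e :: rest)).steps =
          1 + ((expand I T w (e :: visited) e rest).steps +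
            (traverse I T w fuel (e :: visited) r).steps) := by
        simp [traverse, hr]
      have hperm' : ((e :: visited).reverse ++ r).Perm ((e :: visited) ++ r) :=
        (List.reverse_perm _).append_right r
      have hd : Dom (visited ++ e :: rest) ((e :: visited) ++ r) := by
        refine Dom.trans (Dom.of_subset fun x hx => ?_) ((Dom.refl (e :: visited)).append g2)
        exact List.perm_middle.mem_iff.1 hx
      have hl' : GoodList I T w t ((e :: visited).reverse ++ r) := by
        refine ⟨(hperm'.map Entry.state).nodup_iff.2 g1.nodup, ?_, fun x hx => ?_⟩
        · refine List.pairwise_append.2 ⟨?_, g1.sorted, fun x hx y hy => ?_⟩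
          · rw [List.reverse_cons]
            refine List.pairwise_append.2 ⟨hs1, by simp, fun x hx y hy => ?_⟩
            rw [List.mem_singleton.1 hy]
            exact hle x (by simp_all)
          -- Expansion leaves only values at least that of `e` behind `e`, so the whole list stays
          -- sorted.
          · exact (hle x (List.mem_reverse.1 hx)).trans (g1.good y hy).2
        · rcases List.mem_append.1 (hperm'.mem_iff.1 hx) with hx | hx
          exacts [hg x hx, (g1.good x hx).1]
      have hv' : ∀ x ∈ e :: visited, Succeeded I T w t ((e :: visited) ++ r) x := by
        intro x hx
        rcases List.mem_cons.1 hx with rfl | hx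
        · exact g3
        · exact fun j k hjk => (hv x hx j k hjk).mono hd
      obtain ⟨⟨k1, k2, k3⟩, k4⟩ := ih (e :: visited) r hl' hv' (by
        rw [List.length_cons]; omega)
      rw [hval, hsteps]
      refine ⟨⟨k1, hd.trans k2, k3⟩, fun L hL => ?_⟩
      have h1 := k4 L hL
      have h2 := g4 L hL
      have h3 := hL _ hl.nodup hl.good
      simp only [List.length_append, List.length_reverse, List.length_cons] at h1 h3
      -- One of the remaining rounds pays for expanding `e`; there is one because `e` itself counts
      -- towards `L`.
      obtain ⟨m, hm⟩ : ∃ m, L - visited.length = m + 1 := ⟨L - visited.length - 1, by omega⟩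
      rw [show L - (visited.length + 1) = m by omega] at h1
      rw [hm, Nat.succ_mul]
      omega

theorem traverse_spec (hR : StateBound I T w t (roundBound n t)) {l : List (Entry n)}
    (hl : GoodList I T w t l) :
    (GoodList I T w t (traverse I T w (roundBound n t) [] l).val ∧
      Dom l (traverse I T w (roundBound n t) [] l).val ∧
      ∀ x ∈ (traverse I T w (roundBound n t) [] l).val,
        Succeeded I T w t (traverse I T w (roundBound n t) [] l).val x) ∧
    ∀ L, StateBound I T w t L →
      (traverse I T w (roundBound n t) [] l).steps ≤ traverseBound n L :=
  traverse_spec_aux hR _ [] l hl (by simp) (by simp)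

/-! ### Passing from one timestamp to the next -/

theorem advance_list_val : ∀ l : List (Entry n), (∀ e ∈ l, GoodEntry I T w t e) →
    (advance l).val = l.map fun e => entryOf I w e.history (t + 1)
  | [], _ => by simp [advance]
  | e :: l, hl => by
    have ih := advance_list_val l fun x hx => hl x (by simp [hx])
    obtain ⟨h1, h2, h3⟩ := hl e (by simp)
    have := h2.advance_val (w := w) h3
    rw [← h1] at this
    simp [advance, ih, this]

theorem advance_steps_le : ∀ l : List (Entry n),
    (advance l).steps ≤ l.length * (2 * n ^ 2 + 5 * n + 4) + 1
  | [] => by simp [advance]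
  | e :: l => by
    have h1 := advance_steps_le l
    have h2 := advanceEntry_steps_le e
    simp only [advance, bind_steps, step_steps, List.length_cons]
    rw [Nat.succ_mul]
    omega

/-- Ensures that advancing the clock creates no repeated states. With all completion times at most
`t`, no two differences are merged by truncation. -/
theorem stateOf_succ_inj {h h' : List (Fin n × Loc × ℕ)} (hh : ValidHist I T h)
    (hh' : ValidHist I T h') (ht : ∀ x ∈ h, x.2.2 ≤ t) (ht' : ∀ x ∈ h', x.2.2 ≤ t)
    (heq : stateOf I h (t + 1) = stateOf I h' (t + 1)) : stateOf I h t = stateOf I h' t := by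
  obtain ⟨⟨-, h2⟩, h3, h4⟩ := State.ext_iff'.1 heq
  have hopen : ∀ a b, (stateOf I h t).isOpen a b = (stateOf I h' t).isOpen a b := h3
  refine State.ext_iff'.2 ⟨⟨rfl, ?_⟩, hopen, fun a => ?_⟩
  · obtain ⟨i, hi⟩ := hh.lastServer_mem
    obtain ⟨i', hi'⟩ := hh'.lastServer_mem
    have h5 := ht _ hi
    have h6 := ht' _ hi'
    simp only [stateOf] at h2 h5 h6 ⊢
    omega
  · have hiff : ∀ b, (I.edge a b = true ∧ a ∈ h.map Prod.fst ∧ b ∉ h.map Prod.fst) ↔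
        (I.edge a b = true ∧ a ∈ h'.map Prod.fst ∧ b ∉ h'.map Prod.fst) := fun b => by
      simpa only [stateOf, decide_eq_decide] using hopen a b
    have h5 := h4 a
    simp only [stateOf] at h5 ⊢
    by_cases hb : ∃ b, I.edge a b = true ∧ a ∈ h.map Prod.fst ∧ b ∉ h.map Prod.fst
    · have hb' : ∃ b, I.edge a b = true ∧ a ∈ h'.map Prod.fst ∧ b ∉ h'.map Prod.fst := by
        simpa only [hiff] using hb
      rw [if_pos hb, if_pos hb'] at h5 ⊢
      obtain ⟨_, -, ha, -⟩ := hb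
      obtain ⟨_, -, ha', -⟩ := hb'
      obtain ⟨v, hv⟩ := ValidHist.exists_mem ha
      obtain ⟨v', hv'⟩ := ValidHist.exists_mem ha'
      rw [lookup_eq_some_of_mem hh.nodup hv, lookup_eq_some_of_mem hh'.nodup hv'] at h5 ⊢
      have h6 := ht _ hv
      have h7 := ht' _ hv'
      simp only [Option.map_some, Option.some.injEq, Prod.mk.injEq] at h5 h6 h7 ⊢
      exact ⟨h5.1, by omega⟩
    · have hb' : ¬ ∃ b, I.edge a b = true ∧ a ∈ h'.map Prod.fst ∧ b ∉ h'.map Prod.fst := by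
        simpa only [hiff] using hb
      rw [if_neg hb, if_neg hb']

theorem GoodList.advance {l : List (Entry n)} (hl : GoodList I T w t l) :
    GoodList I T w (t + 1) (advance l).val := by
  rw [advance_list_val l hl.good]
  refine ⟨?_, ?_, fun e he => ?_⟩
  · rw [List.map_map]
    refine List.Nodup.map_on (fun x hx y hy hxy => ?_) (List.Nodup.of_map _ hl.nodup)
    refine List.inj_on_of_nodup_map hl.nodup hx hy ?_
    obtain ⟨h1, h2, h3⟩ := hl.good x hx
    obtain ⟨g1, g2, g3⟩ := hl.good y hy
    rw [h1, g1]
    exact stateOf_succ_inj h2 g2 h3 g3 hxy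
  · refine List.pairwise_map.2 (hl.sorted.imp_of_mem fun {x y} hx hy hxy => ?_)
    rw [(hl.good x hx).1, (hl.good y hy).1] at hxy
    exact hxy
  · obtain ⟨x, hx, rfl⟩ := List.mem_map.1 he
    exact ⟨rfl, (hl.good x hx).2.1, fun y hy => ((hl.good x hx).2.2 y hy).trans (Nat.le_succ t)⟩

end Traversal

/-! ### Counting the states -/

section Counting

variable {n : ℕ} {I : Problem n} {T : Times n} {w : Fin n → ℕ∞} {t : ℕ}

instance : Fintype Loc := ⟨{Loc.server, Loc.cloud}, fun l => by cases l <;> simp⟩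

theorem card_loc : Fintype.card Loc = 2 := rfl

/-- States are counted by a decoding map from a finite type that hits all of them; codes need not be
unique. -/
theorem StateBound.of_code {α : Type} [Fintype α] (f : α → State n)
    (hf : ∀ h, ValidHist I T h → (∀ x ∈ h, x.2.2 ≤ t) → ∃ a, f a = stateOf I h t) :
    StateBound I T w t (Fintype.card α) := by
  classical
  intro l hn hl
  rw [← List.length_map (f := Entry.state), ← List.toFinset_card_of_nodup hn]
  refine (Finset.card_le_card (t := Finset.univ.image f) fun s hs => ?_).trans
    Finset.card_image_le
  obtain ⟨e, he, rfl⟩ := List.mem_map.1 (List.mem_toFinset.1 hs)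
  obtain ⟨h1, h2, h3⟩ := hl e he
  obtain ⟨a, ha⟩ := hf _ h2 h3
  rw [Finset.mem_image]
  exact ⟨a, Finset.mem_univ _, ha.trans (congrArg Entry.state h1).symm⟩

theorem StateBound.mono {L L' : ℕ} (h : StateBound I T w t L) (hL : L ≤ L') :
    StateBound I T w t L' := fun l h1 h2 => (h l h1 h2).trans hL

/-- The location and the time since completion of the tail of an open edge. -/
theorem stateOf_info {h : List (Fin n × Loc × ℕ)} (hh : ValidHist I T h) {a b : Fin n}
    (hb : (stateOf I h t).isOpen a b = true) :
    ∃ (l : Loc) (c : Fin (t + 1)), (stateOf I h t).info a = some (l, (c : ℕ)) := by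
  have hb' : I.edge a b = true ∧ a ∈ h.map Prod.fst ∧ b ∉ h.map Prod.fst := by
    simpa only [stateOf, decide_eq_true_eq] using hb
  obtain ⟨v, hv⟩ := ValidHist.exists_mem hb'.2.1
  refine ⟨v.1, ⟨t - v.2, by omega⟩, ?_⟩
  simp only [stateOf]
  rw [if_pos ⟨b, hb'⟩, lookup_eq_some_of_mem hh.nodup hv]
  rfl

theorem stateOf_info_eq_none {h : List (Fin n × Loc × ℕ)} {a : Fin n}
    (hb : ∀ b, ¬ (stateOf I h t).isOpen a b = true) : (stateOf I h t).info a = none := by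
  simp only [stateOf, decide_eq_true_eq] at hb ⊢
  exact if_neg fun ⟨b, hb'⟩ => hb b hb'

/-- A bound without any assumption on cuts, exponential in `n`. It only shows that the fuel of
`traverse` suffices and does not enter the step count. -/
theorem stateBound_roundBound : StateBound I T w t (roundBound n t) := by
  have h := StateBound.of_code (I := I) (T := T) (w := w) (t := t)
    (α := Fin (t + 1) × (Fin n → Fin n → Bool) × (Fin n → Option (Loc × Fin (t + 1))))
    (fun a => ⟨t, a.1, a.2.1, fun i => (a.2.2 i).map fun p => (p.1, (p.2 : ℕ))⟩)
    (fun h hh ht => by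
      -- `Fin.ofNat` reduces modulo `t + 1`, which changes nothing as elapsed times are at most `t`.
      refine ⟨⟨⟨t - lastServer h, by omega⟩, (stateOf I h t).isOpen, fun i =>
        ((stateOf I h t).info i).map fun p => (p.1, Fin.ofNat (t + 1) p.2)⟩, ?_⟩
      refine State.ext_iff'.2 ⟨⟨rfl, rfl⟩, fun _ _ => rfl, fun i => ?_⟩
      by_cases hb : ∃ b, (stateOf I h t).isOpen i b = true
      · obtain ⟨b, hb⟩ := hb
        obtain ⟨l, c, hc⟩ := stateOf_info hh hb
        simp [hc]
      · rw [stateOf_info_eq_none (by simpa using hb)]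
        simp [stateOf_info_eq_none (by simpa using hb)])
  refine h.mono (le_of_eq ?_)
  simp only [Fintype.card_prod, Fintype.card_fun, Fintype.card_fin, Fintype.card_bool,
    Fintype.card_option, card_loc, roundBound, pow_mul, mul_assoc]

/-- The open edges are exactly those leaving the set of processed jobs, which contains the source
and has no incoming edges. -/
theorem card_open_le {h : List (Fin n × Loc × ℕ)} (hh : ValidHist I T h) :
    ({e : Fin n × Fin n | (stateOf I h t).isOpen e.1 e.2 = true} : Finset _).card ≤ I.maxCut := by
  let A : Finset (Fin n) := (h.map Prod.fst).toFinset
  have hA : A ∈ ({A : Finset (Fin n) | I.source ∈ A ∧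
      ∀ j k, I.edge j k = true → k ∈ A → j ∈ A} : Finset (Finset (Fin n))) := by
    rw [Finset.mem_filter]
    refine ⟨Finset.mem_univ _, List.mem_toFinset.2 hh.source_mem_map, fun j k he hk => ?_⟩
    exact List.mem_toFinset.2 (hh.pred_mem he (List.mem_toFinset.1 hk))
  refine le_trans (Finset.card_le_card fun e he => ?_)
    (Finset.le_sup (f := fun A => ({e : Fin n × Fin n | I.edge e.1 e.2 = true ∧ e.1 ∈ A ∧ e.2 ∉ A} :
      Finset (Fin n × Fin n)).card) hA)
  simp only [Finset.mem_filter, Finset.mem_univ, true_and, stateOf, decide_eq_true_eq] at he ⊢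
  simpa only [A, List.mem_toFinset] using he

open Classical in
/-- The state with timestamp `t` given by the time for which the server has been unused and a list
of at most `φ` open edges with the information on their tails. -/
def decodeState (t φ : ℕ)
    (a : Fin (t + 1) × (Fin φ → Option (Fin n × Fin n × Loc × Fin (t + 1)))) : State n where
  time := t
  free := a.1
  isOpen j k := decide (∃ i x, a.2 i = some (j, k, x))
  info j := if h : ∃ x, ∃ i k, a.2 i = some (j, k, x) then some (h.choose.1, h.choose.2) else none

/-- The open edges fit into φ slots, unused ones holding `none`. A used slot holds an edge (n²
choices) with location (2) and elapsed time (t+1) of its tail; the idle time of the server gives the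
leading factor. -/
theorem stateBound_of_maxCut {φ : ℕ} (hφ : I.maxCut ≤ φ) :
    StateBound I T w t ((t + 1) * (n * (n * (2 * (t + 1))) + 1) ^ φ) := by
  have h := StateBound.of_code (I := I) (T := T) (w := w) (t := t) (decodeState (n := n) t φ)
    (fun h hh ht => by
      set s := stateOf I h t with hs
      let O : List (Fin n × Fin n) :=
        ({e : Fin n × Fin n | s.isOpen e.1 e.2 = true} : Finset _).toList
      have hO : ∀ j k, (j, k) ∈ O ↔ s.isOpen j k = true := fun j k => by simp [O]
      have hlen : O.length ≤ φ := by
        rw [Finset.length_toList]; exact (card_open_le hh).trans hφ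
      -- The default value is never used for the tail of an open edge.
      let code : Fin n → Loc × Fin (t + 1) := fun j =>
        ((s.info j).map fun p => (p.1, Fin.ofNat (t + 1) p.2)).getD (Loc.server, 0)
      have hcode : ∀ j k, s.isOpen j k = true → s.info j = some ((code j).1, ((code j).2 : ℕ)) := by
        intro j k hjk
        obtain ⟨l, c, hc⟩ := stateOf_info hh hjk
        simp only [code, hs, hc]
        simp
      let g : Fin φ → Option (Fin n × Fin n × Loc × Fin (t + 1)) := fun i =>
        (O[(i : ℕ)]?).map fun e => (e.1, e.2, code e.1)
      have hg : ∀ j k x, (∃ i, g i = some (j, k, x)) ↔ s.isOpen j k = true ∧ x = code j := by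
        intro j k x
        rw [← hO]
        constructor
        · rintro ⟨i, hi⟩
          obtain ⟨⟨a, b⟩, he, heq⟩ := Option.map_eq_some_iff.1 hi
          simp only [Prod.mk.injEq] at heq
          obtain ⟨rfl, rfl, rfl⟩ := heq
          exact ⟨List.mem_of_getElem? he, rfl⟩
        · rintro ⟨hm, rfl⟩
          obtain ⟨i, hi⟩ := List.mem_iff_getElem?.1 hm
          have : i < φ := ((List.getElem?_eq_some_iff.1 hi).1).trans_le hlen
          exact ⟨⟨i, this⟩, by simp [g, hi]⟩
      refine ⟨⟨⟨t - lastServer h, by omega⟩, g⟩, ?_⟩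
      refine State.ext_iff'.2 ⟨⟨rfl, rfl⟩, fun j k => ?_, fun j => ?_⟩
      · rw [Bool.eq_iff_iff]
        simp only [decodeState, decide_eq_true_eq]
        rw [exists_comm]
        simp only [hg, exists_and_left, exists_eq, and_true]
      · by_cases hb : ∃ k, s.isOpen j k = true
        · obtain ⟨k, hk⟩ := hb
          have hex : ∃ x, ∃ i k, g i = some (j, k, x) := by
            obtain ⟨i, hi⟩ := (hg j k (code j)).2 ⟨hk, rfl⟩
            exact ⟨_, i, k, hi⟩
          obtain ⟨i, k', hi⟩ := hex.choose_spec
          -- All slots with tail `j` carry `code j`, so the choice made in `decodeState` is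
          -- immaterial.
          have := ((hg j k' hex.choose).1 ⟨i, hi⟩).2
          simp only [decodeState]
          rw [dif_pos hex, hcode j k hk, ← this]
        · have hnex : ¬ ∃ x, ∃ i k, g i = some (j, k, x) := by
            rintro ⟨x, i, k, hi⟩
            exact hb ⟨k, ((hg j k x).1 ⟨i, hi⟩).1⟩
          simp only [decodeState]
          rw [dif_neg hnex, hs, stateOf_info_eq_none fun k hk => hb ⟨k, hk⟩])
  refine h.mono (le_of_eq ?_)
  simp only [Fintype.card_prod, Fintype.card_fun, Fintype.card_fin, Fintype.card_option, card_loc]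

end Counting

/-! ### The dynamic program -/

section DynProg

variable {n : ℕ} {I : Problem n} {T : Times n} {w : Fin n → ℕ∞} {t : ℕ}

/-- The state list before the traversal at time `t`. -/
def listBefore (I : Problem n) (T : Times n) (w : Fin n → ℕ∞) : ℕ → List (Entry n)
  | 0 => [entryOf I w [(I.source, Loc.server, 0)] 0]
  | t + 1 => (advance (traverse I T w (roundBound n t) [] (listBefore I T w t)).val).val

/-- The state list after the traversal at time `t`. -/
def listAfter (I : Problem n) (T : Times n) (w : Fin n → ℕ∞) (t : ℕ) : List (Entry n) :=
  (traverse I T w (roundBound n t) [] (listBefore I T w t)).val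

theorem goodList_listBefore : ∀ t, GoodList I T w t (listBefore I T w t)
  | 0 => ⟨by simp [listBefore], by simp [listBefore, SortedByValue], fun e he => by
      rw [listBefore, List.mem_singleton] at he
      subst he
      exact ⟨rfl, .start, by simp [entryOf]⟩⟩
  | t + 1 => (traverse_spec stateBound_roundBound (goodList_listBefore t)).1.1.advance

theorem listAfter_spec (t : ℕ) : GoodList I T w t (listAfter I T w t) ∧
    Dom (listBefore I T w t) (listAfter I T w t) ∧
    ∀ x ∈ listAfter I T w t, Succeeded I T w t (listAfter I T w t) x :=
  (traverse_spec stateBound_roundBound (goodList_listBefore t)).1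

theorem timeLoop_val : ∀ r t, (timeLoop I T w t r (listBefore I T w t)).val =
    listAfter I T w (t + r)
  | 0, t => rfl
  | r + 1, t => by
    have := timeLoop_val r (t + 1)
    rw [Nat.add_right_comm] at this
    exact this

theorem timeLoop_steps_le {L : ℕ} : ∀ r t, (∀ u ≤ t + r, StateBound I T w u L) →
    (timeLoop I T w t r (listBefore I T w t)).steps ≤
      (r + 1) * (traverseBound n L + L * (2 * n ^ 2 + 5 * n + 4) + 2)
  | 0, t, hL => by
    have := (traverse_spec stateBound_roundBound (goodList_listBefore (I := I) (T := T) (w := w) t)).2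
      L (hL t le_rfl)
    simp only [timeLoop]
    omega
  | r + 1, t, hL => by
    have h1 := (traverse_spec stateBound_roundBound
      (goodList_listBefore (I := I) (T := T) (w := w) t)).2 L (hL t (by omega))
    have h2 := timeLoop_steps_le r (t + 1) fun u hu => hL u (by omega)
    have h3 := advance_steps_le (listAfter I T w t)
    have h4 := hL t (by omega) _ (listAfter_spec t).1.nodup (listAfter_spec t).1.good
    have h5 : (listAfter I T w t).length * (2 * n ^ 2 + 5 * n + 4) ≤
        L * (2 * n ^ 2 + 5 * n + 4) := Nat.mul_le_mul_right _ h4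
    have h6 : (timeLoop I T w t (r + 1) (listBefore I T w t)).steps =
        (traverse I T w (roundBound n t) [] (listBefore I T w t)).steps +
          ((advance (listAfter I T w t)).steps +
            (1 + (timeLoop I T w (t + 1) r (listBefore I T w (t + 1))).steps)) := rfl
    rw [h6, Nat.succ_mul (r + 1)]
    omega

/-- Neither history nor value enters the new state: the principle that permits keeping a single
entry per state. -/
theorem extend_state_congr {e e' : Entry n} (h : e.state = e'.state) (j : Fin n) (l : Loc) :
    (extend I w e j l).val.state = (extend I w e' j l).val.state := by
  cases l <;> simp only [extend, bind_val, step_val, tabulate_val, h]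

/-- Every running schedule is represented in the state list. -/
theorem reach_listAfter {h : List (Fin n × Loc × ℕ)} (hh : ValidHist I T h) :
    ∀ t, (∀ x ∈ h, x.2.2 ≤ t) → Reach (listAfter I T w t) (stateOf I h t) (valueOf w h) := by
  -- Letting one unit of time pass without finishing a job.
  have hsucc : ∀ {h : List (Fin n × Loc × ℕ)} {t : ℕ}, ValidHist I T h → (∀ x ∈ h, x.2.2 ≤ t) →
      Reach (listAfter I T w t) (stateOf I h t) (valueOf w h) →
      Reach (listAfter I T w (t + 1)) (stateOf I h (t + 1)) (valueOf w h) := by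
    intro h t hh ht hr
    refine Reach.mono (l := listBefore I T w (t + 1)) ?_ (listAfter_spec (t + 1)).2.1
    obtain ⟨y, hy, hs, hv⟩ := hr
    obtain ⟨h1, h2, h3⟩ := (listAfter_spec t).1.good y hy
    have hval := advance_list_val _ (listAfter_spec (I := I) (T := T) (w := w) t).1.good
    refine ⟨entryOf I w y.history (t + 1), ?_, ?_, ?_⟩
    · show _ ∈ (advance (listAfter I T w t)).val
      rw [hval]
      exact List.mem_map_of_mem hy
    · have g1 := h2.advance_val (w := w) h3
      have g2 := hh.advance_val (w := w) ht
      have g3 : (advanceEntry (entryOf I w y.history t)).val.state =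
          (advanceEntry (entryOf I w h t)).val.state := by
        have : (entryOf I w y.history t).state = (entryOf I w h t).state := by
          rw [← h1]; exact hs
        simp only [advanceEntry, bind_val, step_val, tabulate_val, this]
      rwa [g1, g2] at g3
    · have := congrArg Entry.value h1
      exact this ▸ hv
  induction hh with
  | start =>
    intro t ht
    induction t with
    | zero =>
      exact Reach.mono ⟨_, List.mem_singleton.2 rfl, rfl, le_rfl⟩ (listAfter_spec 0).2.1
    | succ t ih => exact hsucc .start (by simp) (ih (by simp))
  | @cons h j l c hh h1 h2 h3 h4 h5 ih =>
    have hcons : ValidHist I T ((j, l, c) :: h) := .cons hh h1 h2 h3 h4 h5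
    have hbase : Reach (listAfter I T w c) (stateOf I ((j, l, c) :: h) c)
        (valueOf w ((j, l, c) :: h)) := by
      obtain ⟨y, hy, hs, hv⟩ := ih c h3
      obtain ⟨g1, g2, g3⟩ := (listAfter_spec c).1.good y hy
      have hys : stateOf I y.history c = stateOf I h c := by
        rw [← hs, g1]; rfl
      -- The representative `y` of `h` has the same state, so the tests that `j` passes after `h` it
      -- also passes after `y`.
      have hready := (hh.ready_iff (t := c)).2 ⟨h1, h2⟩
      have hfits := (hh.fits_iff h3 h1 h2).2 hcons
      rw [← hys] at hready hfits
      obtain ⟨k1, k2⟩ := g2.ready_iff.1 hready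
      have hvalid := (g2.fits_iff g3 k1 k2).1 hfits
      have hst : stateOf I ((j, l, c) :: y.history) c = stateOf I ((j, l, c) :: h) c := by
        have := extend_state_congr (I := I) (w := w) (e := entryOf I w y.history c)
          (e' := entryOf I w h c) hys j l
        rwa [g2.extend_val k1, hh.extend_val h1] at this
      -- Every entry of the final list has been expanded, including those inserted during the
      -- traversal; this covers several jobs that finish at the same time.
      obtain ⟨z, hz, hzs, hzv⟩ := (listAfter_spec c).2.2 y hy j l hvalid
      refine ⟨z, hz, hzs.trans hst, hzv.trans ?_⟩
      have hyv : valueOf w y.history ≤ valueOf w h :=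
        (congrArg Entry.value g1).symm.le.trans hv
      cases l with
      | server => exact hyv
      | cloud => exact add_le_add_left hyv _
    intro t ht
    have hct : c ≤ t := ht (j, l, c) (by simp)
    induction t, hct using Nat.le_induction with
    | base => exact hbase
    | succ t hct ih' =>
      have ht' : ∀ x ∈ (j, l, c) :: h, x.2.2 ≤ t := by
        intro x hx
        rcases List.mem_cons.1 hx with rfl | hx
        exacts [hct, (h3 x hx).trans hct]
      exact hsucc hcons ht' (ih' ht')

/-- The history covers all jobs. -/
def Complete (h : List (Fin n × Loc × ℕ)) : Prop := ∀ j, j ∈ h.map Prod.fst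

/-- Induction along the edges from the source: an unprocessed job with processed predecessors would
be the head of an open edge. -/
theorem complete_iff {h : List (Fin n × Loc × ℕ)} (hh : ValidHist I T h) :
    (¬ ∃ j k, (stateOf I h t).isOpen j k = true) ↔ Complete h := by
  simp only [stateOf, decide_eq_true_eq]
  constructor
  · intro hno j
    refine I.wellFounded_edge.induction j fun j ih => ?_
    by_cases hj : j = I.source
    · exact hj ▸ hh.source_mem_map
    · obtain ⟨i, hi⟩ := I.exists_pred hj
      by_contra hjn
      exact hno ⟨i, j, hi, ih i (.single hi), hjn⟩
  · rintro hc ⟨j, k, -, -, hk⟩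
    exact hk (hc k)

/-- In a sorted list the first finished entry is a cheapest one. -/
theorem firstFinished_spec (d : ℕ) : ∀ l : List (Entry n), SortedByValue l →
    ((firstFinished d l).val = none ∧
      ∀ e ∈ l, e.state.time = d → ∃ j k, e.state.isOpen j k = true) ∨
    ∃ e ∈ l, (firstFinished d l).val = some e ∧ (¬ ∃ j k, e.state.isOpen j k = true) ∧
      ∀ y ∈ l, y.state.time = d → (¬ ∃ j k, y.state.isOpen j k = true) → e.value ≤ y.value
  | [], _ => by simp [firstFinished]
  | e :: l, hl => by
    obtain ⟨hl1, hl2⟩ := List.pairwise_cons.1 hl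
    by_cases he : e.state.time = d ∧ ¬ ∃ j k, e.state.isOpen j k = true
    · right
      refine ⟨e, by simp, ?_, he.2, fun y hy _ _ => ?_⟩
      · simp only [firstFinished, bind_val, step_val, anyOf_val, ite_val, decide_eq_true_eq,
          Bool.and_eq_true, Bool.not_eq_true', decide_eq_false_iff_not]
        exact if_pos he
      · rcases List.mem_cons.1 hy with rfl | hy
        exacts [le_rfl, hl1 y hy]
    · have hv : (firstFinished d (e :: l)).val = (firstFinished d l).val := by
        simp only [firstFinished, bind_val, step_val, anyOf_val, ite_val, decide_eq_true_eq,
          Bool.and_eq_true, Bool.not_eq_true', decide_eq_false_iff_not]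
        exact if_neg he
      rw [hv]
      rcases firstFinished_spec d l hl2 with ⟨h1, h2⟩ | ⟨x, h1, h2, h3, h4⟩
      · left
        refine ⟨h1, fun y hy ht => ?_⟩
        rcases List.mem_cons.1 hy with rfl | hy
        · by_contra hc; exact he ⟨ht, hc⟩
        · exact h2 y hy ht
      · right
        refine ⟨x, by simp [h1], h2, h3, fun y hy ht hc => ?_⟩
        rcases List.mem_cons.1 hy with rfl | hy
        · exact absurd ⟨ht, hc⟩ he
        · exact h4 y hy ht hc

theorem dynProg_val (d : ℕ) :
    (dynProg I T w d).val = (firstFinished d (listAfter I T w d)).val := by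
  have h1 := timeLoop_val (I := I) (T := T) (w := w) d 0
  rw [Nat.zero_add] at h1
  simp only [dynProg, bind_val, step_val, startEntry_val w]
  rw [← h1]
  rfl

theorem dynProg_sound {d : ℕ} {e : Entry n} (he : (dynProg I T w d).val = some e) :
    ValidHist I T e.history ∧ (∀ x ∈ e.history, x.2.2 ≤ d) ∧ Complete e.history := by
  rw [dynProg_val] at he
  have hgood := (listAfter_spec (I := I) (T := T) (w := w) d).1
  rcases firstFinished_spec d _ hgood.sorted with ⟨h, -⟩ | ⟨x, hx, h, hno, -⟩
  · rw [h] at he; cases he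
  · rw [h] at he
    cases he
    obtain ⟨h1, h2, h3⟩ := hgood.good e hx
    rw [h1] at hno
    exact ⟨h2, h3, (complete_iff h2).1 hno⟩

theorem dynProg_optimal {d : ℕ} {h : List (Fin n × Loc × ℕ)} (hh : ValidHist I T h)
    (hd : ∀ x ∈ h, x.2.2 ≤ d) (hc : Complete h) :
    ∃ e, (dynProg I T w d).val = some e ∧ valueOf w e.history ≤ valueOf w h := by
  rw [dynProg_val]
  have hgood := (listAfter_spec (I := I) (T := T) (w := w) d).1
  obtain ⟨y, hy, hs, hv⟩ := reach_listAfter (w := w) hh d hd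
  have hno : ¬ ∃ j k, y.state.isOpen j k = true := by
    rw [hs]; exact (complete_iff hh).2 hc
  have ht : y.state.time = d := by rw [hs]; rfl
  rcases firstFinished_spec d _ hgood.sorted with ⟨-, h'⟩ | ⟨x, hx, h', -, hmin⟩
  · exact absurd (h' y hy ht) hno
  · refine ⟨x, h', ?_⟩
    have := congrArg Entry.value (hgood.good x hx).1
    have h2 := (hmin y hy ht hno).trans hv
    rw [this] at h2
    exact h2

theorem dynProg_steps_le {d L : ℕ} (hL : ∀ u ≤ d, StateBound I T w u L) :
    (dynProg I T w d).steps ≤ 5 * n ^ 2 + 3 * n + 4 +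
      (d + 1) * (traverseBound n L + L * (2 * n ^ 2 + 5 * n + 4) + 2) +
      L * (n * (2 * n + 1) + 3) := by
  have h1 := startEntry_steps_le (I := I)
  have h2 := timeLoop_steps_le (I := I) (T := T) (w := w) d 0 (by simpa using hL)
  have h3 := firstFinished_steps_le d (listAfter I T w d)
  have h4 := hL d le_rfl _ (listAfter_spec d).1.nodup (listAfter_spec d).1.good
  have h5 : (listAfter I T w d).length * (n * (2 * n + 1) + 3) ≤ L * (n * (2 * n + 1) + 3) :=
    Nat.mul_le_mul_right _ h4
  have h6 := timeLoop_val (I := I) (T := T) (w := w) d 0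
  rw [Nat.zero_add] at h6
  have h7 : (dynProg I T w d).steps = (startEntry I).steps + (1 +
      ((timeLoop I T w 0 d (listBefore I T w 0)).steps +
        (firstFinished d (listAfter I T w d)).steps)) := by
    simp only [dynProg, bind_steps, step_steps, step_val, startEntry_val w]
    rw [← h6]
    rfl
  rw [h7]
  omega

end DynProg

/-! ### From schedules to histories -/

section ToHistory

variable {n : ℕ} {I : Problem n} {T : Times n}

/-- The number of jobs that have to precede `j`. -/
def ancestors (I : Problem n) (j : Fin n) : ℕ := by
  classical
  exact ({i | Relation.TransGen (fun a b => I.edge a b = true) i j} : Finset (Fin n)).card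

/-- `i` precedes `j` but, by acyclicity, not itself. -/
theorem ancestors_lt {i j : Fin n} (h : I.edge i j = true) : ancestors I i < ancestors I j := by
  classical
  refine Finset.card_lt_card (Finset.ssubset_iff_subset_ne.2 ⟨fun k hk => ?_, fun heq => ?_⟩)
  · rw [Finset.mem_filter] at hk ⊢
    exact ⟨hk.1, hk.2.tail h⟩
  · have : i ∈ ({k | Relation.TransGen (fun a b => I.edge a b = true) k j} : Finset (Fin n)) := by
      rw [Finset.mem_filter]
      exact ⟨Finset.mem_univ _, .single h⟩
    rw [← heq, Finset.mem_filter] at this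
    exact I.acyclic i this.2

/-- Jobs that respect precedence and the server can be listed in the order in which the dynamic
program processes them. -/
theorem exists_history {loc : Fin n → Loc} {C : Fin n → ℕ}
    (hloc : loc I.source = Loc.server) (hC : C I.source = 0)
    (hserver : ∀ i j, i ≠ j → i ≠ I.source → j ≠ I.source → loc i = Loc.server →
      loc j = Loc.server → (C i : ℕ∞) + T.proc (loc j) j ≤ (C j : ℕ∞) ∨
        (C j : ℕ∞) + T.proc (loc i) i ≤ (C i : ℕ∞))
    (hprec : ∀ i j, I.edge i j = true →
      (C i : ℕ∞) + ((if loc i = loc j then 0 else T.delay i j : ℕ) : ℕ∞) + T.proc (loc j) j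
        ≤ (C j : ℕ∞)) :
    ∃ h, ValidHist I T h ∧ Complete h ∧ ∀ x ∈ h, x.2 = (loc x.1, C x.1) := by
  classical
  -- Ties in completion time matter. A job of positive length must be listed before the jobs of
  -- length 0 that finish with it, or it would seem to overlap them; jobs of length 0 are then
  -- ordered by precedence through `ancestors`.
  let flag : Fin n → ℕ := fun j => if T.proc (loc j) j = 0 then 1 else 0
  let key : Fin n → ℕ ×ₗ ℕ ×ₗ ℕ := fun j => toLex (C j, toLex (flag j, ancestors I j))
  have hflag : ∀ j, T.proc (loc j) j = 0 → flag j = 1 := fun j h => if_pos h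
  have hflag' : ∀ j, flag j = 0 ∨ flag j = 1 ∧ T.proc (loc j) j = 0 := fun j => by
    by_cases h : T.proc (loc j) j = 0
    · exact .inr ⟨if_pos h, h⟩
    · exact .inl (if_neg h)
  have hkey : ∀ i j, key i ≤ key j → C i ≤ C j ∧ (C i = C j → flag i ≤ flag j) := by
    intro i j h
    rcases Prod.Lex.toLex_le_toLex.1 h with h | ⟨h, h'⟩
    · simp only at h
      exact ⟨h.le, fun h' => absurd h' h.ne⟩
    · simp only at h
      refine ⟨h.le, fun _ => ?_⟩
      rcases Prod.Lex.toLex_le_toLex.1 h' with h' | ⟨h', -⟩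
      exacts [h'.le, h'.le]
  have hkey_edge : ∀ i j, I.edge i j = true → key i < key j := by
    intro i j he
    have h1 : (C i : ℕ∞) + T.proc (loc j) j ≤ C j := by
      refine le_trans ?_ (hprec i j he)
      gcongr
      exact le_self_add
    have h2 : C i ≤ C j := by exact_mod_cast le_self_add.trans h1
    refine Prod.Lex.toLex_lt_toLex.2 ?_
    rcases h2.lt_or_eq with h2 | h2
    · exact .inl h2
    · refine .inr ⟨h2, Prod.Lex.toLex_lt_toLex.2 ?_⟩
      -- If both ends of an edge finish together, the head has length 0, so the flag or the number
      -- of ancestors separates them.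
      have h3 : T.proc (loc j) j = 0 := by
        rw [h2] at h1
        cases hp : T.proc (loc j) j with
        | top => rw [hp] at h1; simp at h1
        | coe p =>
          rw [hp] at h1
          norm_cast at h1 ⊢
          omega
      simp only
      rw [hflag j h3]
      rcases hflag' i with h4 | ⟨h4, -⟩
      · exact .inl (by omega)
      · exact .inr ⟨h4, ancestors_lt he⟩
  -- Greedy construction: always append an unprocessed job with least key. The source heads every
  -- history and is exempt from the order. For m = n the last alternative is impossible, as a
  -- history has at most n jobs.
  have hstep : ∀ m : ℕ, ∃ h, ValidHist I T h ∧ (∀ x ∈ h, x.2 = (loc x.1, C x.1)) ∧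
      (∀ i ∈ h.map Prod.fst, i ≠ I.source → ∀ j, j ∉ h.map Prod.fst → key i ≤ key j) ∧
      (Complete h ∨ m < h.length) := by
    intro m
    induction m with
    | zero =>
      refine ⟨_, .start, by simp [hloc, hC], ?_, .inr (by simp)⟩
      intro i hi hne
      exact absurd (by simpa using hi) hne
    | succ m ih =>
      obtain ⟨h, hv, hx, hk, hc⟩ := ih
      by_cases hcomp : Complete h
      · exact ⟨h, hv, hx, hk, .inl hcomp⟩
      have hlen := hc.resolve_left hcomp
      obtain ⟨j₀, hj₀⟩ := not_forall.1 hcomp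
      obtain ⟨j, hj, hmin⟩ := Finset.exists_min_image
        ({j | j ∉ h.map Prod.fst} : Finset (Fin n)) key
        ⟨j₀, by rw [Finset.mem_filter]; exact ⟨Finset.mem_univ _, hj₀⟩⟩
      rw [Finset.mem_filter] at hj
      replace hj := hj.2
      replace hmin : ∀ k, k ∉ h.map Prod.fst → key j ≤ key k := fun k hk => hmin k (by
        rw [Finset.mem_filter]; exact ⟨Finset.mem_univ _, hk⟩)
      have hpred : ∀ k, I.edge k j = true → k ∈ h.map Prod.fst := fun k he => by
        by_contra hk
        exact absurd (hmin k hk) (not_le.2 (hkey_edge k j he))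
      have hjs : j ≠ I.source := fun h' => hj (h' ▸ hv.source_mem_map)
      have hmem : ∀ x ∈ h, x.1 ∈ h.map Prod.fst := fun x hx => List.mem_map_of_mem hx
      have hp : T.proc (loc j) j ≤ C j := by
        obtain ⟨i, hi⟩ := I.exists_pred hjs
        exact le_trans le_add_self (hprec i j hi)
      refine ⟨(j, loc j, C j) :: h, .cons hv hj hpred ?_ ?_ ?_, ?_, ?_, .inr (by simpa using hlen)⟩
      · intro x hxh
        rw [hx x hxh]
        by_cases hs : x.1 = I.source
        · simp [hs, hC]
        · exact (hkey _ _ (hk _ (hmem x hxh) hs j hj)).1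
      · intro hls x hxh hxs
        have hx2 := hx x hxh
        rw [hx2] at hxs ⊢
        simp only at hxs ⊢
        by_cases hs : x.1 = I.source
        · rw [hs, hC]
          simpa using hp
        · have hne : x.1 ≠ j := fun h' => hj (h' ▸ hmem x hxh)
          obtain ⟨h1, h2⟩ := hkey _ _ (hk _ (hmem x hxh) hs j hj)
          rcases hserver x.1 j hne hs hjs hxs hls with h3 | h3
          · exact h3
          -- The server order seems reversed. Then both jobs finish together and the one listed
          -- first has length 0; by the flags, so has `j`, and the order is irrelevant.
          · have h4 : C j ≤ C x.1 := by exact_mod_cast le_self_add.trans h3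
            have h5 := le_antisymm h1 h4
            have h6 : T.proc (loc x.1) x.1 = 0 := by
              rw [h5] at h3
              cases hq : T.proc (loc x.1) x.1 with
              | top => rw [hq] at h3; simp at h3
              | coe p =>
                rw [hq] at h3
                norm_cast at h3 ⊢
                omega
            have h7 := h2 h5
            rw [hflag _ h6] at h7
            rcases hflag' j with h8 | ⟨-, h8⟩
            · omega
            · rw [h8, add_zero]; exact_mod_cast h1
      · intro x hxh he
        have hx2 := hx x hxh
        rw [hx2]
        exact hprec _ _ he
      · intro x hxh
        rcases List.mem_cons.1 hxh with rfl | hxh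
        exacts [rfl, hx x hxh]
      · intro i hi hs k hk'
        rw [List.map_cons, List.mem_cons] at hi hk'
        rw [not_or] at hk'
        rcases hi with rfl | hi
        exacts [hmin k hk'.2, hk i hi hs k hk'.2]
  obtain ⟨h, hv, hx, -, hc⟩ := hstep n
  exact ⟨h, hv, hc.resolve_right (not_lt.2 hv.length_le), hx⟩

theorem valueOf_eq_sum (w : Fin n → ℕ∞) (loc : Fin n → Loc) :
    ∀ h : List (Fin n × Loc × ℕ), (h.map Prod.fst).Nodup → (∀ x ∈ h, x.2.1 = loc x.1) →
      valueOf w h = ∑ j ∈ (h.map Prod.fst).toFinset with loc j = Loc.cloud, w j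
  | [], _, _ => by simp [valueOf]
  | (j, l, t) :: h, hn, hl => by
    rw [List.map_cons, List.nodup_cons] at hn
    have ih := valueOf_eq_sum w loc h hn.2 fun x hx => hl x (by simp [hx])
    have hj : l = loc j := hl (j, l, t) (by simp)
    rw [List.map_cons, List.toFinset_cons, Finset.filter_insert]
    cases l with
    | server => rw [if_neg (by rw [← hj]; simp)]; exact ih
    | cloud =>
      rw [if_pos hj.symm, Finset.sum_insert (by
          simp only [Finset.mem_filter, List.mem_toFinset, hn.1, false_and, not_false_eq_true]),
        add_comm, ← ih]
      rfl

theorem valueOf_eq_cost {h : List (Fin n × Loc × ℕ)} (hh : ValidHist I T h) (hc : Complete h)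
    {π : Schedule n} (hl : ∀ x ∈ h, x.2.1 = π.loc x.1) :
    valueOf I.times.cloud h = I.cost π := by
  rw [valueOf_eq_sum _ π.loc h hh.nodup hl, Problem.cost]
  congr 1
  ext j
  simp only [Finset.mem_filter, List.mem_toFinset, Finset.mem_univ, hc j]

end ToHistory

/-! ### Scaling -/

section Scale

variable {n : ℕ} {I : Problem n} {T : Times n} {σ : ℝ}

theorem scaleTimes_proc_coe {l : Loc} {j : Fin n} {p : ℕ} (h : T.proc l j = p) :
    (scaleTimes σ T).val.proc l j = (⌊(p : ℝ) / σ⌋₊ : ℕ∞) := by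
  cases l with
  | server =>
    simp only [Times.proc, Nat.cast_inj] at h
    simp [Times.proc, scaleTimes, scaleNat, h]
  | cloud =>
    simp only [Times.proc] at h
    simp [Times.proc, scaleTimes, scaleENat, scaleNat, h]

theorem scaleTimes_proc_top {l : Loc} {j : Fin n} (h : T.proc l j = ⊤) :
    (scaleTimes σ T).val.proc l j = ⊤ := by
  cases l with
  | server => simp [Times.proc] at h
  | cloud =>
    simp only [Times.proc] at h
    simp [Times.proc, scaleTimes, scaleENat, h]

theorem scaleTimes_delay (i j : Fin n) :
    (scaleTimes σ T).val.delay i j = ⌊(T.delay i j : ℝ) / σ⌋₊ := by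
  simp [scaleTimes, scaleNat]

theorem scaleTimes_steps_le : (scaleTimes σ T).steps ≤ 4 * n ^ 2 + 9 * n + 1 := by
  have h0 : ∀ x, (scaleNat σ x).steps = 2 := fun x => by simp [scaleNat]
  have h1 : (tabulate fun j => scaleNat σ (T.server j)).steps ≤ n * (2 + 1) :=
    tabulate_steps_le fun j => (h0 _).le
  have h2 : (tabulate fun j => scaleENat σ (T.cloud j)).steps ≤ n * (4 + 1) :=
    tabulate_steps_le fun j => by
      simp only [scaleENat, bind_steps, step_steps]
      split_ifs <;> simp [h0]
  have h3 : (tabulate fun i => tabulate fun j => scaleNat σ (T.delay i j)).steps ≤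
      n * (n * (2 + 1) + 1) :=
    tabulate_steps_le fun i => tabulate_steps_le fun j => (h0 _).le
  have h4 : n * (n * (2 + 1) + 1) = 3 * n ^ 2 + n := by ring
  simp only [scaleTimes, bind_steps, step_steps] at h1 h2 h3 ⊢
  nlinarith

/-- Superadditivity of the floor is why rounding down preserves all constraints. -/
theorem floor_div_add_le (hσ : 0 < σ) (a b : ℕ) :
    ⌊(a : ℝ) / σ⌋₊ + ⌊(b : ℝ) / σ⌋₊ ≤ ⌊((a + b : ℕ) : ℝ) / σ⌋₊ := by
  rw [Nat.cast_add, add_div]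
  refine Nat.le_floor ?_
  rw [Nat.cast_add]
  exact add_le_add (Nat.floor_le (by positivity)) (Nat.floor_le (by positivity))

theorem floor_div_mono (hσ : 0 < σ) {a b : ℕ} (h : a ≤ b) :
    ⌊(a : ℝ) / σ⌋₊ ≤ ⌊(b : ℝ) / σ⌋₊ := by
  apply Nat.floor_mono
  gcongr

/-- Induction from the sink backwards: every other job has a successor, which finishes no earlier.
-/
theorem Problem.Valid.completion_le_makespan {π : Schedule n} (h : I.Valid π) (j : Fin n) :
    π.completion j ≤ I.makespan π := by
  induction j using I.wellFounded_edge_swap.induction with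
  | _ j ih =>
  by_cases hj : j = I.sink
  · exact hj ▸ le_rfl
  · obtain ⟨k, hk⟩ := I.exists_succ hj
    refine le_trans ?_ (ih k (.single hk))
    have := h.precedence j k hk
    rw [add_assoc] at this
    exact_mod_cast le_self_add.trans this

/-- A valid schedule gives a history for the scaled times, with the same cost. -/
theorem exists_scaled_history (hσ : 0 < σ) {ρ : Schedule n} (hρ : I.Valid ρ) {d : ℕ}
    (hd : I.makespan ρ ≤ d) :
    ∃ h, ValidHist I (scaleTimes σ I.times).val h ∧ Complete h ∧
      (∀ x ∈ h, x.2.2 ≤ ⌈(d : ℝ) / σ⌉₊) ∧ valueOf I.times.cloud h = I.cost ρ := by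
  -- Histories start with the source at time 0, whereas ρ may finish it later; moving it forward
  -- only relaxes the constraints of its successors.
  let C : Fin n → ℕ := fun j => if j = I.source then 0 else ⌊(ρ.completion j : ℝ) / σ⌋₊
  have hC : ∀ j, j ≠ I.source → C j = ⌊(ρ.completion j : ℝ) / σ⌋₊ := fun j h => if_neg h
  have hC' : ∀ j, C j ≤ ⌊(ρ.completion j : ℝ) / σ⌋₊ := fun j => by
    by_cases h : j = I.source
    · simp [C, h]
    · exact (hC j h).le
  have hfin : ∀ j, ∃ p : ℕ, I.times.proc (ρ.loc j) j = p := fun j =>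
    ⟨_, (ENat.natCast_toNat (ne_top_of_le_ne_top (ENat.natCast_ne_top _) (hρ.start_nonneg j))).symm⟩
  have hsrc : ρ.loc I.source = Loc.server := by
    cases hl : ρ.loc I.source with
    | server => rfl
    | cloud =>
      obtain ⟨p, hp⟩ := hfin I.source
      rw [hl] at hp
      have := (I.cloud_eq_top_iff I.source).2 (.inl rfl)
      rw [show I.times.proc Loc.cloud I.source = ⊤ from this] at hp
      simp at hp
  -- Covers the server constraint (c = 0) and the precedence constraint (c the effective delay). The
  -- source is excluded as `j` because it has been moved.
  have hmain : ∀ i j (c : ℕ), j ≠ I.source →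
      (ρ.completion i : ℕ∞) + c + I.procIn ρ j ≤ ρ.completion j →
      (C i : ℕ∞) + (⌊(c : ℝ) / σ⌋₊ : ℕ) + (scaleTimes σ I.times).val.proc (ρ.loc j) j ≤ C j := by
    intro i j c hj h
    obtain ⟨p, hp⟩ := hfin j
    rw [scaleTimes_proc_coe hp, hC j hj]
    rw [Problem.procIn, hp] at h
    norm_cast at h ⊢
    calc _ ≤ ⌊(ρ.completion i : ℝ) / σ⌋₊ + ⌊(c : ℝ) / σ⌋₊ + ⌊(p : ℝ) / σ⌋₊ := by
          have := hC' i; omega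
      _ ≤ ⌊((ρ.completion i + c : ℕ) : ℝ) / σ⌋₊ + ⌊(p : ℝ) / σ⌋₊ :=
          Nat.add_le_add_right (floor_div_add_le hσ _ _) _
      _ ≤ _ := (floor_div_add_le hσ _ _).trans (floor_div_mono hσ h)
  obtain ⟨h, hv, hc, hx⟩ := exists_history (I := I) (T := (scaleTimes σ I.times).val)
    (loc := ρ.loc) (C := C) hsrc (if_pos rfl)
    (fun i j hij hi hj hli hlj => by
      rcases hρ.server_disjoint i j hij hli hlj with h | h
      · left
        simpa using hmain i j 0 hj (by simpa using h)
      · right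
        simpa using hmain j i 0 hi (by simpa using h))
    (fun i j he => by
      have hj : j ≠ I.source := by
        rintro rfl
        rw [I.edge_source] at he
        cases he
      have h := hmain i j _ hj (hρ.precedence i j he)
      convert h using 4
      rw [Problem.delayIn, scaleTimes_delay]
      split_ifs <;> simp)
  refine ⟨h, hv, hc, fun x hxh => ?_, valueOf_eq_cost hv hc fun x hxh => by rw [hx x hxh]⟩
  rw [hx x hxh]
  refine (hC' _).trans ((floor_div_mono hσ ?_).trans (Nat.floor_le_ceil _))
  exact (hρ.completion_le_makespan _).trans hd

end Scale

/-! ### The order of the start times -/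

section StartOrder

variable {n : ℕ} {I : Problem n} {T : Times n}

theorem insertByStart_perm (x : Fin n × Loc × ℕ) : ∀ L : List (Fin n × Loc × ℕ),
    (insertByStart x L).val.Perm (x :: L)
  | [] => by simp [insertByStart]
  | y :: L => by
    by_cases h : x.2.2 < y.2.2
    · simp [insertByStart, h]
    · have hv : (insertByStart x (y :: L)).val = y :: (insertByStart x L).val := by
        simp [insertByStart, h]
      rw [hv]
      exact ((insertByStart_perm x L).cons y).trans (List.Perm.swap x y L)

theorem insertByStart_steps_le (x : Fin n × Loc × ℕ) : ∀ L : List (Fin n × Loc × ℕ),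
    (insertByStart x L).steps ≤ 2 * L.length + 2
  | [] => by simp [insertByStart]
  | y :: L => by
    have ih := insertByStart_steps_le x L
    simp only [insertByStart, bind_steps, step_steps, List.length_cons]
    split_ifs <;> simp only [bind_steps, step_steps] <;> omega

/-- `x` goes behind all start times at most its own, so `R` is needed only in the direction that the
start times dictate; `hR` extends the strict inequality to the rest of the list. -/
theorem insertByStart_pairwise {R : Fin n × Loc × ℕ → Fin n × Loc × ℕ → Prop}
    (hR : ∀ x y, R x y → x.2.2 ≤ y.2.2) (x : Fin n × Loc × ℕ) :
    ∀ L : List (Fin n × Loc × ℕ), L.Pairwise R → (∀ y ∈ L, y.2.2 ≤ x.2.2 → R y x) →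
      (∀ y ∈ L, x.2.2 < y.2.2 → R x y) → (insertByStart x L).val.Pairwise R
  | [], _, _, _ => by simp [insertByStart]
  | y :: L, hL, h1, h2 => by
    obtain ⟨hL1, hL2⟩ := List.pairwise_cons.1 hL
    by_cases h : x.2.2 < y.2.2
    · have hv : (insertByStart x (y :: L)).val = x :: y :: L := by simp [insertByStart, h]
      rw [hv]
      refine List.pairwise_cons.2 ⟨fun z hz => h2 z hz ?_, hL⟩
      rcases List.mem_cons.1 hz with rfl | hz
      exacts [h, h.trans_le (hR _ _ (hL1 z hz))]
    · have hv : (insertByStart x (y :: L)).val = y :: (insertByStart x L).val := by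
        simp [insertByStart, h]
      rw [hv]
      refine List.pairwise_cons.2 ⟨fun z hz => ?_, insertByStart_pairwise hR x L hL2
        (fun z hz => h1 z (by simp [hz])) (fun z hz => h2 z (by simp [hz]))⟩
      rcases List.mem_cons.1 ((insertByStart_perm x L).mem_iff.1 hz) with rfl | hz
      exacts [h1 y (by simp) (not_lt.1 h), hL1 z hz]

/-- The job with its location and start time. -/
def toStart (T : Times n) (x : Fin n × Loc × ℕ) : Fin n × Loc × ℕ :=
  (x.1, x.2.1, x.2.2 - (T.proc x.2.1 x.1).toNat)

theorem startOrder_perm : ∀ h : List (Fin n × Loc × ℕ),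
    (startOrder T h).val.Perm (h.map (toStart T))
  | [] => by simp [startOrder]
  | (j, l, t) :: h => by
    simp only [startOrder, bind_val, step_val, List.map_cons]
    exact (insertByStart_perm _ _).trans ((startOrder_perm h).cons _)

theorem startOrder_steps_le : ∀ h : List (Fin n × Loc × ℕ),
    (startOrder T h).steps ≤ h.length * (2 * h.length + 4) + 1
  | [] => by simp [startOrder]
  | (j, l, t) :: h => by
    have h1 := startOrder_steps_le h
    have h2 := insertByStart_steps_le (j, l, t - (T.proc l j).toNat) (startOrder T h).val
    rw [(startOrder_perm h).length_eq, List.length_map] at h2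
    simp only [startOrder, bind_steps, step_steps, step_val, List.length_cons]
    nlinarith

/-- `x` may be restored before `y`: the start times are in order, `y` does not precede `x`, and `y`
starts late enough in the scaled schedule. -/
def Before (I : Problem n) (T : Times n) (x y : Fin n × Loc × ℕ) : Prop :=
  x.2.2 ≤ y.2.2 ∧ I.edge y.1 x.1 = false ∧
  (I.edge x.1 y.1 = true → x.2.2 + (T.proc x.2.1 x.1).toNat +
    (if x.2.1 = y.2.1 then 0 else T.delay x.1 y.1) ≤ y.2.2) ∧
  (x.2.1 = Loc.server → y.2.1 = Loc.server → x.2.2 + (T.proc x.2.1 x.1).toNat ≤ y.2.2)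

/-- Every job but the source has a predecessor in the history, whose constraint yields a nonnegative
start. So the truncated start times are true ones and all lengths are finite. -/
theorem ValidHist.proc_le {h : List (Fin n × Loc × ℕ)} (h0 : T.server I.source = 0)
    (hh : ValidHist I T h) : ∀ x ∈ h, T.proc x.2.1 x.1 ≤ (x.2.2 : ℕ∞) := by
  induction hh with
  | start => simp [Times.proc, h0]
  | @cons h j l t hh hj hp ht hs hprec ih =>
    intro x hx
    rcases List.mem_cons.1 hx with rfl | hx
    · obtain ⟨k, hk⟩ := I.exists_pred (fun h' : j = I.source => hj (h' ▸ hh.source_mem_map))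
      obtain ⟨v, hv⟩ := ValidHist.exists_mem (hp k hk)
      exact le_add_self.trans (hprec _ hv hk)
    · exact ih x hx

/-- The jobs are inserted from the oldest on. The newest one precedes none of the others, and it
starts after its predecessors are done and, on the server, after all earlier server jobs. -/
theorem startOrder_pairwise {h : List (Fin n × Loc × ℕ)} (h0 : T.server I.source = 0)
    (hh : ValidHist I T h) : (startOrder T h).val.Pairwise (Before I T) := by
  induction hh with
  | start => simp [startOrder, insertByStart]
  | @cons h j l t hh hj hp ht hs hprec ih =>
    have hproc := (ValidHist.cons hh hj hp ht hs hprec).proc_le h0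
    obtain ⟨p, hpj⟩ := ENat.ne_top_iff_exists.1
      (ne_top_of_le_ne_top (ENat.natCast_ne_top _) (hproc (j, l, t) (by simp)))
    have hpt : p ≤ t := by
      have := hproc (j, l, t) (by simp)
      simp only at this hpj
      rw [← hpj] at this
      exact_mod_cast this
    simp only [startOrder, bind_val, step_val]
    simp only at hpj
    have hprop : ∀ y ∈ (startOrder T h).val, I.edge j y.1 = false ∧
        (I.edge y.1 j = true → y.2.2 + (T.proc y.2.1 y.1).toNat +
          (if y.2.1 = l then 0 else T.delay y.1 j) ≤ t - p) ∧
        (y.2.1 = Loc.server → l = Loc.server →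
          y.2.2 + (T.proc y.2.1 y.1).toNat ≤ t - p) := by
      intro y hy
      obtain ⟨⟨k, lk, c⟩, hx, rfl⟩ := List.mem_map.1 ((startOrder_perm h).mem_iff.1 hy)
      have hpk := hproc (k, lk, c) (List.mem_cons_of_mem _ hx)
      have hprec' := hprec _ hx
      have hs' := fun h' : l = Loc.server => hs h' _ hx
      simp only [toStart] at hpk hprec' hs' ⊢
      obtain ⟨q, hq⟩ := ENat.ne_top_iff_exists.1
        (ne_top_of_le_ne_top (ENat.natCast_ne_top _) hpk)
      rw [← hq] at hpk ⊢
      rw [← hpj] at hprec' hs'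
      norm_cast at hpk hprec'
      simp only [ENat.toNat_natCast]
      refine ⟨?_, fun he => ?_, fun hk hl => ?_⟩
      · by_contra he
        exact hj (hh.pred_mem (by simpa using he) (List.mem_map_of_mem hx))
      · have := hprec' he
        refine Nat.le_sub_of_add_le (le_trans (le_of_eq ?_) this)
        rw [Nat.sub_add_cancel hpk]
        rfl
      · have := hs' hl hk
        norm_cast at this
        omega
    have hpn : (T.proc l j).toNat = p := by rw [← hpj]; rfl
    refine insertByStart_pairwise (fun x y h => h.1) _ _ ih (fun y hy hle => ?_)
      (fun y hy hlt => ?_)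
    · obtain ⟨h1, h2, h3⟩ := hprop y hy
      rw [hpn] at hle ⊢
      exact ⟨hle, h1, h2, h3⟩
    -- A newer job that starts strictly before `y` can neither depend on `y` nor share the server
    -- with it.
    · obtain ⟨h1, h2, h3⟩ := hprop y hy
      rw [hpn] at hlt ⊢
      simp only at hlt
      refine ⟨hlt.le, ?_, fun he => ?_, fun hl hk => ?_⟩
      · by_contra he
        have := h2 (by simpa using he)
        omega
      · simp only at he
        rw [h1] at he
        cases he
      · have := h3 hk hl
        omega

end StartOrder

/-! ### Restoring a schedule -/

section Restore

variable {n : ℕ} {I : Problem n} {σ : ℝ}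

/-- What `placeJob` does, in terms of the start time that it chooses. -/
theorem placeJob_spec (P : Partial n) (j : Fin n) (l : Loc) (s : ℕ) :
    ∃ start : ℝ, (placeJob I σ P (j, l, s)).val =
        ⟨start - σ * s, if l = Loc.server then start + (I.times.proc l j).toNat else P.serverFree,
          fun i => if i = j then some (l, start + (I.times.proc l j).toNat) else P.placed i⟩ ∧
      σ * s + P.shift ≤ start ∧ (l = Loc.server → P.serverFree ≤ start) ∧
      (∀ i li ci, I.edge i j = true → P.placed i = some (li, ci) →
        ci + (if li = l then 0 else I.times.delay i j : ℕ) ≤ start) ∧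
      ∀ B : ℝ, σ * s + P.shift ≤ B → (l = Loc.server → P.serverFree ≤ B) →
        (∀ i li ci, I.edge i j = true → P.placed i = some (li, ci) →
          ci + (if li = l then 0 else I.times.delay i j : ℕ) ≤ B) → start ≤ B := by
  let body : ℝ → Fin n → Timed ℝ := fun cur i => do
    let e ← step (I.edge i j)
    if e then do
      let y ← step (P.placed i)
      match y with
      | none => step cur
      | some (li, ci) =>
        let same ← step (decide (li = l))
        if same then step (max cur ci) else do
          let c ← step (I.times.delay i j)
          let r ← step (ci + (c : ℝ))
          step (max cur r)
    else step cur
  have hbody : ∀ cur i, cur ≤ (body cur i).val ∧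
      (∀ li ci, I.edge i j = true → P.placed i = some (li, ci) →
        ci + (if li = l then 0 else I.times.delay i j : ℕ) ≤ (body cur i).val) ∧
      ∀ B : ℝ, cur ≤ B → (∀ li ci, I.edge i j = true → P.placed i = some (li, ci) →
        ci + (if li = l then 0 else I.times.delay i j : ℕ) ≤ B) → (body cur i).val ≤ B := by
    intro cur i
    by_cases he : I.edge i j = true
    · cases hy : P.placed i with
      | none =>
        have hv : (body cur i).val = cur := by simp [body, he, hy]
        rw [hv]
        exact ⟨le_rfl, by simp, fun B h _ => h⟩
      | some v =>
        obtain ⟨li, ci⟩ := v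
        have hv : (body cur i).val =
            max cur (ci + (if li = l then 0 else I.times.delay i j : ℕ)) := by
          by_cases hl : li = l <;> simp [body, he, hy, hl]
        rw [hv]
        refine ⟨le_max_left _ _, fun li' ci' _ h => ?_, fun B h1 h2 => max_le h1 (h2 _ _ he rfl)⟩
        cases h
        exact le_max_right _ _
    · have hv : (body cur i).val = cur := by simp [body, he]
      rw [hv]
      exact ⟨le_rfl, fun _ _ h => absurd h he, fun B h _ => h⟩
  let base : ℝ := if l = Loc.server then max (σ * s + P.shift) P.serverFree else σ * s + P.shift
  obtain ⟨-, h2, h3⟩ := forEach_spec (body := body) (fun _ => True) (· ≤ ·)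
    (fun i b => ∀ li ci, I.edge i j = true → P.placed i = some (li, ci) →
        ci + (if li = l then 0 else I.times.delay i j : ℕ) ≤ b)
    (fun _ => le_rfl) (fun _ _ _ => le_trans) (fun _ _ _ h h' li ci he hp => (h li ci he hp).trans h')
    (List.finRange n) base (fun i _ b _ => ⟨trivial, (hbody b i).1, (hbody b i).2.1⟩) trivial
  refine ⟨(forEach body base (List.finRange n)).val, ?_, ?_, ?_, ?_, ?_⟩
  -- The total shift after `j` is how much later than σ s the job starts.
  · have hshift : ∀ x : ℝ, P.shift + (x - (σ * s + P.shift)) = x - σ * s := fun x => by ring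
    rw [← hshift]
    cases l <;>
    · simp only [placeJob, bind_val, step_val, tabulate_val, ite_val, decide_eq_true_eq]
      rfl
  · refine le_trans ?_ h2
    simp only [base]
    split_ifs
    exacts [le_max_left _ _, le_rfl]
  · intro hl
    refine le_trans ?_ h2
    simp only [base, if_pos hl]
    exact le_max_right _ _
  · exact fun i => h3 i (List.mem_finRange i)
  · intro B hB1 hB2 hB3
    -- A second analysis of the same loop, now with the invariant that the maximum stays below `B`.
    refine (forEach_spec (body := body) (· ≤ B) (fun _ _ => True) (fun _ _ => True)
      (fun _ => trivial) (fun _ _ _ _ _ => trivial) (fun _ _ _ _ _ => trivial)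
      (List.finRange n) base
      (fun i _ b hb => ⟨(hbody b i).2.2 B hb (hB3 i), trivial, trivial⟩) ?_).1
    simp only [base]
    split_ifs with hl
    exacts [max_le hB1 (hB2 hl), hB1]

theorem placeJob_steps_le (P : Partial n) (x : Fin n × Loc × ℕ) :
    (placeJob I σ P x).steps ≤ 10 * n + 9 := by
  obtain ⟨j, l, s⟩ := x
  have h1 : ∀ base : ℝ, (forEach (fun cur i => do
    let e ← step (I.edge i j)
    if e then do
      let y ← step (P.placed i)
      match y with
      | none => step cur
      | some (li, ci) =>
        let same ← step (decide (li = l))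
        if same then step (max cur ci) else do
          let c ← step (I.times.delay i j)
          let r ← step (ci + (c : ℝ))
          step (max cur r)
    else step cur) base (List.finRange n)).steps ≤ n * (6 + 1) + 1 := by
    intro base
    have := forEach_steps_le (K := 6) (body := fun cur i => do
      let e ← step (I.edge i j)
      if e then do
        let y ← step (P.placed i)
        match y with
        | none => step cur
        | some (li, ci) =>
          let same ← step (decide (li = l))
          if same then step (max cur ci) else do
            let c ← step (I.times.delay i j)
            let r ← step (ci + (c : ℝ))
            step (max cur r)
      else step cur) (fun _ => True) (List.finRange n) base (fun i _ cur _ => ⟨trivial, by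
        simp only [bind_steps, step_steps, step_val]
        split_ifs
        · cases P.placed i with
          | none => simp
          | some v =>
            simp only [bind_steps, step_steps, step_val]
            split_ifs <;> simp
        · simp⟩) trivial
    rwa [List.length_finRange] at this
  have h2 : ∀ c : ℝ, (tabulate fun i => do
      let b ← step (decide (i = j))
      if b then step (some (l, c)) else step (P.placed i)).steps ≤ n * (2 + 1) := fun c =>
    tabulate_steps_le fun i => by
      simp only [bind_steps, step_steps, step_val]
      split_ifs <;> simp
  have h3 : (placeJob I σ P (j, l, s)).steps ≤
      1 + (1 + (1 + ((n * (6 + 1) + 1) + (1 + (1 + (1 + (1 + (n * (2 + 1) + 1)))))))) := by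
    cases l <;>
    · refine Nat.add_le_add_left (Nat.add_le_add_left (Nat.add_le_add_left
        (Nat.add_le_add (h1 _) ?_) 1) 1) 1
      refine Nat.add_le_add_left (Nat.add_le_add_left (Nat.add_le_add_left
        (Nat.add_le_add_left (Nat.add_le_add_right (h2 _) 1) 1) 1) 1) 1
  omega

/-- The invariant of the restoration, after the jobs in `done` have been scheduled. -/
structure Restored (I : Problem n) (σ : ℝ) (done : List (Fin n × Loc × ℕ)) (P : Partial n) :
    Prop where
  placed_of_mem : ∀ x ∈ done, ∃ c, P.placed x.1 = some (x.2.1, c)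
  of_placed : ∀ i l c, P.placed i = some (l, c) → ∃ s, (i, l, s) ∈ done ∧
    ((I.times.proc l i).toNat : ℝ) ≤ c ∧ c ≤ σ * s + P.shift + (I.times.proc l i).toNat
  shift_nonneg : 0 ≤ P.shift
  shift_le : P.shift ≤ 2 * σ * (done.length - 1 : ℕ)
  serverFree : P.serverFree = 0 ∨ ∃ i, P.placed i = some (Loc.server, P.serverFree)
  le_serverFree : ∀ i c, P.placed i = some (Loc.server, c) → c ≤ P.serverFree
  precedence : ∀ i j li lj ci cj, I.edge i j = true → P.placed i = some (li, ci) →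
    P.placed j = some (lj, cj) →
    ci + (if li = lj then 0 else I.times.delay i j : ℕ) + (I.times.proc lj j).toNat ≤ cj
  disjoint : ∀ i j ci cj, i ≠ j → P.placed i = some (Loc.server, ci) →
    P.placed j = some (Loc.server, cj) →
    ci + (I.times.proc Loc.server j).toNat ≤ cj ∨ cj + (I.times.proc Loc.server i).toNat ≤ ci

theorem le_mul_floor_div_add_one (hσ : 0 < σ) (p : ℕ) : (p : ℝ) ≤ σ * (⌊(p : ℝ) / σ⌋₊ + 1) := by
  have := (div_lt_iff₀' hσ).1 (Nat.lt_floor_add_one ((p : ℝ) / σ))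
  exact this.le

/-- Rounding down loses less than one unit σ; an infinite time counts as 0 on both sides. -/
theorem toNat_proc_le (hσ : 0 < σ) {T : Times n} (l : Loc) (j : Fin n) :
    ((T.proc l j).toNat : ℝ) ≤ σ * (((scaleTimes σ T).val.proc l j).toNat + 1) := by
  cases h : T.proc l j with
  | top =>
    rw [scaleTimes_proc_top h]
    simpa using hσ.le
  | coe p =>
    rw [scaleTimes_proc_coe h]
    exact le_mul_floor_div_add_one hσ p

theorem delay_le (hσ : 0 < σ) {T : Times n} (i j : Fin n) :
    (T.delay i j : ℝ) ≤ σ * ((scaleTimes σ T).val.delay i j + 1) := by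
  rw [scaleTimes_delay]
  exact le_mul_floor_div_add_one hσ _

/-- Jobs placed so far are late by at most the current shift, apart from rounding. Measured from σ s
plus that shift, a new job waits at most σ for a processing time and σ for a delay, so the shift
grows by at most 2σ per job. -/
theorem Restored.placeJob (hσ : 0 < σ) {done : List (Fin n × Loc × ℕ)} {P : Partial n}
    (hP : Restored I σ done P) {x : Fin n × Loc × ℕ} (hnew : x.1 ∉ done.map Prod.fst)
    (hx : ∀ y ∈ done, Before I (scaleTimes σ I.times).val y x) :
    Restored I σ (done ++ [x]) (ServerCloud.placeJob I σ P x).val := by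
  obtain ⟨j, l, s⟩ := x
  simp only at hnew
  obtain ⟨start, hval, h1, h2, h3, h4⟩ := placeJob_spec (I := I) (σ := σ) P j l s
  rw [hval]
  set p : ℝ := ((I.times.proc l j).toNat : ℝ) with hp
  have hp0 : 0 ≤ p := Nat.cast_nonneg _
  have hs0 : 0 ≤ σ * s := by positivity
  have hshift : P.shift ≤ start - σ * s := by linarith
  have hne : ∀ {i li ci}, P.placed i = some (li, ci) → i ≠ j := by
    rintro i li ci hi rfl
    obtain ⟨s', hs', -⟩ := hP.of_placed _ _ _ hi
    exact hnew (List.mem_map_of_mem hs')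
  have hcases : ∀ {i li ci}, (if i = j then some (l, start + p) else P.placed i) = some (li, ci) →
      (i = j ∧ l = li ∧ start + p = ci) ∨ (i ≠ j ∧ P.placed i = some (li, ci)) := by
    intro i li ci h
    split_ifs at h with hij
    · cases h; exact .inl ⟨hij, rfl, rfl⟩
    · exact .inr ⟨hij, h⟩
  refine ⟨fun y hy => ?_, fun i li ci hi => ?_, ?_, ?_, ?_, fun i c hi => ?_,
    fun i k li lk ci ck he hi hk => ?_, fun i k ci ck hik hi hk => ?_⟩
  · rcases List.mem_append.1 hy with hy | hy
    · obtain ⟨c, hc⟩ := hP.placed_of_mem y hy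
      exact ⟨c, by simp only; rw [if_neg (hne hc), hc]⟩
    · rw [List.mem_singleton.1 hy]
      exact ⟨start + p, if_pos rfl⟩
  · simp only
    rcases hcases hi with ⟨rfl, rfl, rfl⟩ | ⟨hij, hi⟩
    · refine ⟨s, by simp, ?_, ?_⟩
      · have := hP.shift_nonneg; rw [← hp]; linarith
      · rw [← hp]; linarith
    · obtain ⟨s', hm, g1, g2⟩ := hP.of_placed _ _ _ hi
      exact ⟨s', List.mem_append_left _ hm, g1, by linarith⟩
  · exact hP.shift_nonneg.trans hshift
  · simp only [List.length_append, List.length_singleton, Nat.add_sub_cancel]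
    by_cases hd : done = []
    · subst hd
      have hnone : ∀ i li ci, P.placed i ≠ some (li, ci) := by
        intro i li ci hi
        obtain ⟨s', hm, -⟩ := hP.of_placed _ _ _ hi
        simp at hm
      have hsf : P.serverFree = 0 :=
        hP.serverFree.resolve_right fun ⟨i, hi⟩ => hnone _ _ _ hi
      have h5 := h4 (σ * s + P.shift) le_rfl
        (fun _ => by rw [hsf]; exact add_nonneg hs0 hP.shift_nonneg)
        (fun i li ci _ hi => absurd hi (hnone _ _ _))
      have h6 := hP.shift_le
      simp only [List.length_nil, Nat.zero_sub] at h6 ⊢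
      linarith
    · have hlen : 1 ≤ done.length := List.length_pos_of_ne_nil hd
      -- The chosen start is the least possible one, so it suffices that each constraint holds at
      -- this time.
      have h5 : start ≤ σ * s + P.shift + 2 * σ := by
        refine h4 _ (by linarith) (fun hl => ?_) fun i li ci he hi => ?_
        · rcases hP.serverFree with hsf | ⟨i, hi⟩
          · rw [hsf]; linarith [hP.shift_nonneg]
          · obtain ⟨s', hm, -, g2⟩ := hP.of_placed _ _ _ hi
            obtain ⟨-, -, -, g3⟩ := hx _ hm
            have g4 : (s' : ℝ) + (((scaleTimes σ I.times).val.proc Loc.server i).toNat : ℝ) ≤ s := by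
              exact_mod_cast g3 rfl hl
            have g5 := toNat_proc_le (T := I.times) hσ Loc.server i
            have g6 := mul_le_mul_of_nonneg_left g4 hσ.le
            linarith
        · obtain ⟨s', hm, -, g2⟩ := hP.of_placed _ _ _ hi
          obtain ⟨-, -, g3, -⟩ := hx _ hm
          have g3' := g3 he
          have g5 := toNat_proc_le (T := I.times) hσ li i
          have g7 := delay_le (T := I.times) hσ i j
          simp only at g3'
          split_ifs at g3' ⊢ with hl
          · have g4 : (s' : ℝ) + (((scaleTimes σ I.times).val.proc li i).toNat : ℝ) ≤ s := by
              exact_mod_cast g3'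
            have g6 := mul_le_mul_of_nonneg_left g4 hσ.le
            push_cast
            linarith
          · have g4 : (s' : ℝ) + (((scaleTimes σ I.times).val.proc li i).toNat : ℝ) +
                ((scaleTimes σ I.times).val.delay i j : ℝ) ≤ s := by
              exact_mod_cast g3'
            have g6 := mul_le_mul_of_nonneg_left g4 hσ.le
            linarith
      have h6 := hP.shift_le
      rw [Nat.cast_sub hlen] at h6
      push_cast at h6
      linarith
  · simp only
    by_cases hl : l = Loc.server
    · refine .inr ⟨j, ?_⟩
      rw [if_pos rfl, if_pos hl, hl]
    · rw [if_neg hl]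
      refine hP.serverFree.imp_right fun ⟨i, hi⟩ => ⟨i, ?_⟩
      rw [if_neg (hne hi), hi]
  · simp only
    rcases hcases hi with ⟨-, hl, rfl⟩ | ⟨hij, hi⟩
    · rw [if_pos hl]
    · have h5 := hP.le_serverFree i c hi
      split_ifs with hl
      · linarith [h2 hl]
      · exact h5
  · rcases hcases hi with ⟨rfl, rfl, rfl⟩ | ⟨hij, hi'⟩
    · rcases hcases hk with ⟨rfl, rfl, rfl⟩ | ⟨hkj, hk⟩
      · rw [I.edge_irrefl] at he
        cases he
      -- No job placed earlier is a successor of the new one.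
      · obtain ⟨s', hm, -⟩ := hP.of_placed _ _ _ hk
        have := (hx _ hm).2.1
        simp only at this
        rw [this] at he
        cases he
    · rcases hcases hk with ⟨rfl, rfl, rfl⟩ | ⟨hkj, hk⟩
      · rw [← hp]
        have := h3 i li ci he hi'
        linarith
      · exact hP.precedence i k li lk ci ck he hi' hk
  · rcases hcases hi with ⟨rfl, rfl, rfl⟩ | ⟨hij, hi'⟩
    · rcases hcases hk with ⟨rfl, -, -⟩ | ⟨hkj, hk⟩
      · exact absurd rfl hik
      · right
        rw [← hp]
        linarith [hP.le_serverFree k ck hk, h2 rfl]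
    · rcases hcases hk with ⟨rfl, rfl, rfl⟩ | ⟨hkj, hk⟩
      · left
        rw [← hp]
        linarith [hP.le_serverFree i ci hi', h2 rfl]
      · exact hP.disjoint i k ci ck hik hi' hk

theorem Restored.forEach (hσ : 0 < σ) : ∀ (rest done : List (Fin n × Loc × ℕ)) (P : Partial n),
    Restored I σ done P → ((done ++ rest).map Prod.fst).Nodup →
    (done ++ rest).Pairwise (Before I (scaleTimes σ I.times).val) →
    Restored I σ (done ++ rest) (forEach (ServerCloud.placeJob I σ) P rest).val
  | [], done, P, hP, _, _ => by simpa using hP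
  | x :: rest, done, P, hP, hn, hb => by
    rw [forEach_cons_val]
    rw [List.append_cons] at hn hb ⊢
    refine Restored.forEach hσ rest (done ++ [x]) _ (hP.placeJob hσ ?_ ?_) hn hb
    · rw [List.map_append] at hn
      have := hn.of_append_left
      rw [List.map_append, List.nodup_append'] at this
      exact fun h => this.2.2 h (by simp)
    · exact fun y hy => (List.pairwise_append.1 (List.pairwise_append.1 hb).1).2.2 y hy x (by simp)

/-- Restoring a complete history for the scaled times gives a valid schedule. -/
theorem restore_spec (hσ : 0 < σ) {h : List (Fin n × Loc × ℕ)} {D : ℕ}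
    (hh : ValidHist I (scaleTimes σ I.times).val h) (hc : Complete h) (hD : ∀ x ∈ h, x.2.2 ≤ D) :
    I.Valid (restore I σ (scaleTimes σ I.times).val h).val ∧
    (I.makespan (restore I σ (scaleTimes σ I.times).val h).val : ℝ) ≤
      σ * D + 2 * σ * (n - 1 : ℕ) ∧
    ∀ x ∈ h, x.2.1 = (restore I σ (scaleTimes σ I.times).val h).val.loc x.1 := by
  set T := (scaleTimes σ I.times).val with hT
  set π := (restore I σ T h).val with hπ
  set L := (startOrder T h).val with hL
  set P := (forEach (placeJob I σ) ⟨0, 0, fun _ => none⟩ L).val with hPdef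
  have hloc : ∀ j l c, P.placed j = some (l, c) → π.loc j = l ∧ π.completion j = ⌊c⌋₊ := by
    intro j l c hj
    simp [hπ, restore, ← hL, ← hPdef, hj]
  have h0 : T.server I.source = 0 := by
    have : T.proc Loc.server I.source = _ :=
      scaleTimes_proc_coe (T := I.times) (l := Loc.server) (p := 0)
        (by simp [Times.proc, I.server_source])
    simpa [Times.proc] using this
  have hperm := startOrder_perm (T := T) h
  have hjobs : (h.map (toStart T)).map Prod.fst = h.map Prod.fst := by
    rw [List.map_map]; rfl
  have hnodup : (L.map Prod.fst).Nodup := by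
    rw [(hperm.map Prod.fst).nodup_iff, hjobs]
    exact hh.nodup
  have hR : Restored I σ L P := by
    have := Restored.forEach (I := I) hσ L [] ⟨0, 0, fun _ => none⟩
      ⟨by simp, by simp, le_rfl, by simp, .inl rfl, by simp, by simp, by simp⟩
      (by simpa using hnodup) (by simpa using startOrder_pairwise h0 hh)
    simpa using this
  have hlen : L.length ≤ n := by
    rw [hperm.length_eq, List.length_map]; exact hh.length_le
  have hplaced : ∀ x ∈ h, ∃ c, P.placed x.1 = some (x.2.1, c) := fun x hx =>
    hR.placed_of_mem (toStart T x) (hperm.mem_iff.2 (List.mem_map_of_mem hx))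
  have hex : ∀ j, ∃ l c, P.placed j = some (l, c) ∧ (∃ t, (j, l, t) ∈ h) := by
    intro j
    obtain ⟨⟨l, t⟩, hv⟩ := ValidHist.exists_mem (hc j)
    obtain ⟨c, hc⟩ := hplaced _ hv
    exact ⟨l, c, hc, t, hv⟩
  -- Infinite times stay infinite under scaling and cannot occur in a history.
  have hfin : ∀ j l t, (j, l, t) ∈ h → I.times.proc l j = ((I.times.proc l j).toNat : ℕ∞) := by
    intro j l t hm
    refine (ENat.natCast_toNat fun htop => ?_).symm
    have := hh.proc_le h0 _ hm
    simp only at this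
    rw [hT, scaleTimes_proc_top htop] at this
    simp at this
  refine ⟨⟨fun j => ?_, fun i j hij hi hj => ?_, fun i j he => ?_⟩, ?_, fun x hx => ?_⟩
  · obtain ⟨l, c, hj, t, hm⟩ := hex j
    obtain ⟨h1, h2⟩ := hloc j l c hj
    obtain ⟨s, -, h3, -⟩ := hR.of_placed j l c hj
    rw [Problem.procIn, h1, h2, hfin j l t hm]
    exact_mod_cast Nat.le_floor h3
  · obtain ⟨li, ci, hpi, ti, hmi⟩ := hex i
    obtain ⟨lj, cj, hpj, tj, hmj⟩ := hex j
    obtain ⟨h1, h2⟩ := hloc i li ci hpi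
    obtain ⟨h3, h4⟩ := hloc j lj cj hpj
    rw [h1] at hi
    rw [h3] at hj
    subst hi hj
    have hi0 : 0 ≤ ci := by
      obtain ⟨_, -, h, -⟩ := hR.of_placed _ _ _ hpi
      exact le_trans (Nat.cast_nonneg _) h
    have hj0 : 0 ≤ cj := by
      obtain ⟨_, -, h, -⟩ := hR.of_placed _ _ _ hpj
      exact le_trans (Nat.cast_nonneg _) h
    rw [Problem.procIn, Problem.procIn, h1, h2, h3, h4, hfin i _ ti hmi, hfin j _ tj hmj]
    refine (hR.disjoint i j ci cj hij hpi hpj).imp (fun h => ?_) fun h => ?_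
    -- Rounding down commutes with adding the integer processing time, so the order on the server
    -- survives.
    · rw [← Nat.cast_add, Nat.cast_le, ← Nat.floor_add_natCast hi0]
      exact Nat.floor_mono h
    · rw [← Nat.cast_add, Nat.cast_le, ← Nat.floor_add_natCast hj0]
      exact Nat.floor_mono h
  · obtain ⟨li, ci, hpi, ti, hmi⟩ := hex i
    obtain ⟨lj, cj, hpj, tj, hmj⟩ := hex j
    obtain ⟨h1, h2⟩ := hloc i li ci hpi
    obtain ⟨h3, h4⟩ := hloc j lj cj hpj
    have hi0 : 0 ≤ ci := by
      obtain ⟨_, -, h, -⟩ := hR.of_placed _ _ _ hpi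
      exact le_trans (Nat.cast_nonneg _) h
    have h5 := hR.precedence i j li lj ci cj he hpi hpj
    rw [Problem.procIn, Problem.delayIn, h1, h2, h3, h4, hfin j _ tj hmj, ← Nat.cast_add,
      ← Nat.cast_add, Nat.cast_le, add_assoc, ← Nat.floor_add_natCast hi0]
    refine Nat.floor_mono (le_trans (le_of_eq ?_) h5)
    push_cast
    ring
  · obtain ⟨l, c, hj, t, hm⟩ := hex I.sink
    obtain ⟨h1, h2⟩ := hloc _ l c hj
    obtain ⟨s, hs, h3, h4⟩ := hR.of_placed _ l c hj
    obtain ⟨⟨j', l', t'⟩, hm', heq⟩ := List.mem_map.1 (hperm.mem_iff.1 hs)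
    have hsD : s ≤ D := by
      have h5 := hD _ hm'
      have h6 : t' - (T.proc l' j').toNat = s := congrArg (fun x => x.2.2) heq
      simp only at h5
      omega
    -- For the cloud this is only the convention that `toNat` of infinity is 0.
    have hp0 : (I.times.proc l I.sink).toNat = 0 := by
      cases l with
      | server => simp [Times.proc, I.server_sink]
      | cloud =>
        have h5 := (I.cloud_eq_top_iff I.sink).2 (.inr rfl)
        simp [Times.proc, h5]
    rw [hp0] at h3 h4
    have h5 : (I.makespan π : ℝ) ≤ c := by
      rw [Problem.makespan, h2]
      exact Nat.floor_le (by simpa using h3)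
    have h6 : (s : ℝ) ≤ D := by exact_mod_cast hsD
    have h7 := mul_le_mul_of_nonneg_left h6 hσ.le
    have h8 : ((L.length - 1 : ℕ) : ℝ) ≤ ((n - 1 : ℕ) : ℝ) := by
      exact_mod_cast Nat.sub_le_sub_right hlen 1
    have h9 := mul_le_mul_of_nonneg_left h8 (by positivity : 0 ≤ 2 * σ)
    have h10 := hR.shift_le
    push_cast at h4
    linarith
  · obtain ⟨c, hc⟩ := hplaced x hx
    exact (hloc _ _ _ hc).1.symm

theorem restore_steps_le {T : Times n} {h : List (Fin n × Loc × ℕ)} (hh : h.length ≤ n) :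
    (restore I σ T h).steps ≤ 12 * n ^ 2 + 22 * n + 4 := by
  have h1 := startOrder_steps_le (T := T) h
  have h2 : h.length * (2 * h.length + 4) ≤ n * (2 * n + 4) := by gcongr
  have h3 : (tabulate (n := n) fun _ => step (none : Option (Loc × ℝ))).steps ≤ n * (1 + 1) :=
    tabulate_steps_le fun _ => le_rfl
  have h4 := forEach_steps_le (body := placeJob I σ) (K := 10 * n + 9) (fun _ => True)
    (startOrder T h).val ⟨0, 0, fun _ => none⟩
    (fun x _ P _ => ⟨trivial, placeJob_steps_le P x⟩) trivial
  rw [(startOrder_perm h).length_eq, List.length_map] at h4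
  have h5 : h.length * (10 * n + 9 + 1) ≤ n * (10 * n + 9 + 1) := by gcongr
  have h6 : ∀ P : Partial n, (tabulate fun j => do
      let y ← step (P.placed j)
      match y with
      | some (l, _) => step l
      | none => step Loc.server).steps ≤ n * (2 + 1) := fun P => tabulate_steps_le fun j => by
    simp only [bind_steps, step_steps, step_val]
    cases P.placed j <;> simp
  have h7 : ∀ P : Partial n, (tabulate fun j => do
      let y ← step (P.placed j)
      match y with
      | some (_, c) => step ⌊c⌋₊
      | none => step 0).steps ≤ n * (2 + 1) := fun P => tabulate_steps_le fun j => by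
    simp only [bind_steps, step_steps, step_val]
    cases P.placed j <;> simp
  have h8 : (restore I σ T h).steps ≤ (startOrder T h).steps + (n * (1 + 1) + (1 +
      ((forEach (placeJob I σ) ⟨0, 0, fun _ => none⟩ (startOrder T h).val).steps +
        (n * (2 + 1) + (n * (2 + 1) + 1))))) :=
    Nat.add_le_add_left (Nat.add_le_add h3 (Nat.add_le_add_left (Nat.add_le_add_left
      (Nat.add_le_add (h6 _) (Nat.add_le_add_right (h7 _) 1)) _) _)) _
  nlinarith

end Restore

/-! ### The dynamic program with scaling -/

section Main

variable {n : ℕ} {I : Problem n}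

/-- The scaling factor. -/
def scaleFactor (n d : ℕ) (ε : ℝ) : ℝ := ε * d / (2 * n)

theorem scaledDynProg_val (d : ℕ) (ε : ℝ) : (scaledDynProg I d ε).val =
    (dynProg I (scaleTimes (scaleFactor n d ε) I.times).val I.times.cloud
      ⌈(d : ℝ) / scaleFactor n d ε⌉₊).val.map fun e =>
        (restore I (scaleFactor n d ε) (scaleTimes (scaleFactor n d ε) I.times).val
          e.history).val := by
  simp only [scaledDynProg, bind_val, step_val]
  rw [show ε * (d : ℝ) / (2 * (n : ℝ)) = scaleFactor n d ε from rfl]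
  cases (dynProg I (scaleTimes (scaleFactor n d ε) I.times).val I.times.cloud
      ⌈(d : ℝ) / scaleFactor n d ε⌉₊).val <;> rfl

/-- A bound for the number of steps of the whole algorithm with `n` jobs, if the scaled deadline is
less than `D` and there are at most `L` states at each time. -/
def totalBound (n D L : ℕ) : ℕ :=
  5 + (4 * n ^ 2 + 9 * n + 1) +
    (5 * n ^ 2 + 3 * n + 4 + D * (traverseBound n L + L * (2 * n ^ 2 + 5 * n + 4) + 2) +
      L * (n * (2 * n + 1) + 3)) + (12 * n ^ 2 + 22 * n + 5)

theorem scaledDynProg_steps_le {d L : ℕ} {ε : ℝ}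
    (hL : ∀ u ≤ ⌈(d : ℝ) / scaleFactor n d ε⌉₊,
      StateBound I (scaleTimes (scaleFactor n d ε) I.times).val I.times.cloud u L) :
    (scaledDynProg I d ε).steps ≤ totalBound n (⌈(d : ℝ) / scaleFactor n d ε⌉₊ + 1) L := by
  have h1 := scaleTimes_steps_le (T := I.times) (σ := scaleFactor n d ε)
  have h2 := dynProg_steps_le hL
  simp only [scaledDynProg, bind_steps, step_steps, step_val, totalBound]
  rw [show ε * (d : ℝ) / (2 * (n : ℝ)) = scaleFactor n d ε from rfl]
  cases he : (dynProg I (scaleTimes (scaleFactor n d ε) I.times).val I.times.cloud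
      ⌈(d : ℝ) / scaleFactor n d ε⌉₊).val with
  | none => simp only [step_steps]; omega
  | some e =>
    have h3 := restore_steps_le (I := I) (σ := scaleFactor n d ε)
      (T := (scaleTimes (scaleFactor n d ε) I.times).val) (dynProg_sound he).1.length_le
    simp only [bind_steps, step_steps]
    omega

/-- The bound is monotone, and with all arguments equal to X it is a polynomial of degree 6; 1000
generously covers its coefficients. -/
theorem totalBound_le {n D L X : ℕ} (hn : n ≤ X) (hD : D ≤ X) (hL : L ≤ X) (hX : 1 ≤ X) :
    totalBound n D L ≤ 1000 * X ^ 6 := by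
  have hmono : totalBound n D L ≤ totalBound X X X := by
    unfold totalBound traverseBound expandBound
    gcongr
  refine hmono.trans ?_
  have hpow : ∀ i ≤ 6, X ^ i ≤ X ^ 6 := fun i hi => Nat.pow_le_pow_right hX hi
  have h0 := hpow 0 (by norm_num)
  have h1 := hpow 1 (by norm_num)
  have h2 := hpow 2 (by norm_num)
  have h3 := hpow 3 (by norm_num)
  have h4 := hpow 4 (by norm_num)
  have h5 := hpow 5 (by norm_num)
  unfold totalBound traverseBound expandBound
  ring_nf at *
  omega

/-- With X = n + D + 3 the number of contents of a slot is at most 3X³ ≤ X⁴; the summand 3 is there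
for the last inequality. -/
theorem stateCount_le {n D φ u : ℕ} (hu : u ≤ D) :
    (u + 1) * (n * (n * (2 * (u + 1))) + 1) ^ φ ≤ (n + D + 3) ^ (4 * φ + 1) := by
  have h1 : n * (n * (2 * (u + 1))) + 1 ≤ (n + D + 3) ^ 4 := by
    calc n * (n * (2 * (u + 1))) + 1
        ≤ (n + D + 3) * ((n + D + 3) * (2 * (n + D + 3))) + 1 := by gcongr <;> omega
      _ ≤ (n + D + 3) ^ 3 * 3 := by
          have : 1 ≤ (n + D + 3) ^ 3 := Nat.one_le_pow _ _ (by omega)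
          nlinarith
      _ ≤ (n + D + 3) ^ 3 * (n + D + 3) := by gcongr; omega
      _ = (n + D + 3) ^ 4 := by ring
  calc (u + 1) * (n * (n * (2 * (u + 1))) + 1) ^ φ
      ≤ (n + D + 3) * ((n + D + 3) ^ 4) ^ φ := by gcongr <;> omega
    _ = (n + D + 3) ^ (4 * φ + 1) := by rw [← pow_mul, pow_succ, mul_comm]

/-- For bounded cut size, the number of steps is polynomial in the size and the scaled deadline. -/
theorem scaledDynProg_steps_le_pow {d φ : ℕ} {ε : ℝ} (hφ : I.maxCut ≤ φ) :
    (scaledDynProg I d ε).steps ≤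
      1000 * (n + ⌈(d : ℝ) / scaleFactor n d ε⌉₊ + 3) ^ (6 * (4 * φ + 1)) := by
  set D := ⌈(d : ℝ) / scaleFactor n d ε⌉₊
  have hle : n + D + 3 ≤ (n + D + 3) ^ (4 * φ + 1) := Nat.le_self_pow (by omega) _
  refine (scaledDynProg_steps_le (L := (n + D + 3) ^ (4 * φ + 1))
    fun u hu => (stateBound_of_maxCut hφ).mono (stateCount_le hu)).trans ?_
  rw [mul_comm 6, pow_mul]
  exact totalBound_le (by omega) (by omega) le_rfl (by omega)

theorem Problem.pos (I : Problem n) : 0 < n := I.source.pos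

/-- The quotient d/σ is 2n/ε: scaling removes the deadline from the running time. -/
theorem scaledDeadline_le {d : ℕ} {ε : ℝ} (hn : 0 < n) (hd : 0 < d) (hε : 0 < ε) :
    ((n + ⌈(d : ℝ) / scaleFactor n d ε⌉₊ + 3 : ℕ) : ℝ) ≤ 7 * ((n : ℝ) + 1 / ε) ^ 2 := by
  have hn' : (1 : ℝ) ≤ n := by exact_mod_cast hn
  have hd' : (0 : ℝ) < d := by exact_mod_cast hd
  have heq : (d : ℝ) / scaleFactor n d ε = 2 * n * (1 / ε) := by
    unfold scaleFactor
    field_simp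
  have he : 0 < 1 / ε := by positivity
  rw [heq]
  have h1 := (Nat.ceil_lt_add_one (a := 2 * (n : ℝ) * (1 / ε)) (by positivity)).le
  push_cast
  nlinarith [mul_pos (by linarith : (0 : ℝ) < n) he]

theorem scaleFactor_pos {d : ℕ} {ε : ℝ} (hn : 0 < n) (hd : 0 < d) (hε : 0 < ε) :
    0 < scaleFactor n d ε := by
  unfold scaleFactor
  positivity

/-- Rounding the deadline up costs at most σ and the shifts at most 2(n−1)σ, together less than 2nσ
= εd. -/
theorem restored_makespan_le {d : ℕ} {ε : ℝ} (hn : 0 < n) (hd : 0 < d) (hε : 0 < ε) :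
    scaleFactor n d ε * ⌈(d : ℝ) / scaleFactor n d ε⌉₊ + 2 * scaleFactor n d ε * (n - 1 : ℕ) ≤
      (1 + ε) * d := by
  have hσ := scaleFactor_pos hn hd hε
  have h1 := (Nat.ceil_lt_add_one (a := (d : ℝ) / scaleFactor n d ε) (by positivity)).le
  have h2 := mul_le_mul_of_nonneg_left h1 hσ.le
  rw [mul_add, mul_div_cancel₀ _ hσ.ne'] at h2
  have h3 : 2 * scaleFactor n d ε * n = ε * d := by
    have : (0 : ℝ) < n := by exact_mod_cast hn
    unfold scaleFactor
    field_simp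
  rw [Nat.cast_sub hn]
  push_cast
  linarith

theorem scaledDynProg_sound {d : ℕ} {ε : ℝ} (hd : 0 < d) (hε : 0 < ε) {π : Schedule n}
    (hπ : (scaledDynProg I d ε).val = some π) :
    I.Valid π ∧ (I.makespan π : ℝ) ≤ (1 + ε) * d := by
  rw [scaledDynProg_val] at hπ
  obtain ⟨e, he, rfl⟩ := Option.map_eq_some_iff.1 hπ
  obtain ⟨h1, h2, h3⟩ := dynProg_sound he
  obtain ⟨h4, h5, -⟩ := restore_spec (scaleFactor_pos I.pos hd hε) h1 h3 h2
  exact ⟨h4, h5.trans (restored_makespan_le I.pos hd hε)⟩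

/-- Restoring changes times but not locations, so the cost is the value found by the dynamic
program, which is minimal among scaled histories; one of these comes from ρ. -/
theorem scaledDynProg_optimal {d : ℕ} {ε : ℝ} (hd : 0 < d) (hε : 0 < ε) {ρ : Schedule n}
    (hρ : I.Valid ρ) (hm : I.makespan ρ ≤ d) :
    ∃ π, (scaledDynProg I d ε).val = some π ∧ I.cost π ≤ I.cost ρ := by
  have hσ := scaleFactor_pos I.pos hd hε
  obtain ⟨h, h1, h2, h3, h4⟩ := exists_scaled_history hσ hρ hm
  obtain ⟨e, he, hv⟩ := dynProg_optimal (w := I.times.cloud) h1 h3 h2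
  obtain ⟨g1, g2, g3⟩ := dynProg_sound he
  refine ⟨_, by rw [scaledDynProg_val, he]; rfl, ?_⟩
  rw [← valueOf_eq_cost g1 g3 (restore_spec hσ g1 g3 g2).2.2, ← h4]
  exact hv

end Main

end ServerCloud

end

theorem mainTheorem4 (φ : ℕ) :
    ∃ c k : ℕ, ∀ (n : ℕ) (I : ServerCloud.Problem n) (d : ℕ) (ε : ℝ),
      I.maxCut ≤ φ → 0 < d → 0 < ε →
      ((ServerCloud.scaledDynProg I d ε).steps : ℝ) ≤ (c : ℝ) * ((n : ℝ) + 1 / ε) ^ k ∧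
      (∀ π : ServerCloud.Schedule n, (ServerCloud.scaledDynProg I d ε).val = some π →
        I.Valid π ∧ (I.makespan π : ℝ) ≤ (1 + ε) * (d : ℝ)) ∧
      (∀ ρ : ServerCloud.Schedule n, I.Valid ρ → I.makespan ρ ≤ d →
        ∃ π : ServerCloud.Schedule n, (ServerCloud.scaledDynProg I d ε).val = some π ∧
          I.cost π ≤ I.cost ρ) := by
  -- Degree 6 in the number of states, at most X^(4φ+1), with X = n + ⌈d/σ⌉ + 3 ≤ 7(n + 1/ε)².
  refine ⟨1000 * 7 ^ (6 * (4 * φ + 1)), 2 * (6 * (4 * φ + 1)), fun n I d ε hφ hd hε =>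
    ⟨?_, fun π hπ => ServerCloud.scaledDynProg_sound hd hε hπ,
      fun ρ hρ hm => ServerCloud.scaledDynProg_optimal hd hε hρ hm⟩⟩
  calc ((ServerCloud.scaledDynProg I d ε).steps : ℝ)
      ≤ ((1000 * (n + ⌈(d : ℝ) / ServerCloud.scaleFactor n d ε⌉₊ + 3) ^ (6 * (4 * φ + 1)) : ℕ) :
          ℝ) := by exact_mod_cast ServerCloud.scaledDynProg_steps_le_pow hφ
    _ = 1000 * ((n + ⌈(d : ℝ) / ServerCloud.scaleFactor n d ε⌉₊ + 3 : ℕ) : ℝ) ^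
          (6 * (4 * φ + 1)) := by push_cast; ring
    _ ≤ 1000 * (7 * ((n : ℝ) + 1 / ε) ^ 2) ^ (6 * (4 * φ + 1)) := by
        gcongr
        exact ServerCloud.scaledDeadline_le I.pos hd hε
    _ = _ := by
        rw [mul_pow, ← pow_mul]
        push_cast
        ring
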